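/- Let $V$ be a quadratic space over $\mathbb{Q}$ with positive definite quadratic form $Q$ and bilinear form $B$, $2B(x,y)=Q(x+y)-Q(x)-Q(y)$, let $O(V)=\{\sigma\in\mathrm{GL}(V): B(\sigma x,\sigma y)=B(x,y)\text{ for all }x,y\in V\}$ and $O^+(V)=O(V)\cap\mathrm{SL}(V)$. Let $L=\mathbb{Z}e_1+\mathbb{Z}e_2$ be a binary $\mathbb{Z}$-lattice on $V$ (so $e_1,e_2$ is a $\mathbb{Q}$-basis of $V$) with $Q(L)\subseteq\mathbb{Z}$, and let $d_L=\det(B(e_i,e_j))$. Assume that $-4d_L$ is the discriminant of an imaginary quadratic field. For $m\ge 1$ let $a_m^+(L)$ (resp. $a_m(L)$) be the number of $O^+(V)$-inequivalent (resp. $O(V)$-inequivalent) sublattices $K\subseteq L$ of index $m$, where $K_1,K_2$ are equivalent if $\sigma(K_1)=K_2$ for some $\sigma$ in the group, and put $$\zeta_L^+(s)=\sum_{m=1}^\infty a_m^+(L)\,m^{-s},\qquad \zeta_L(s)=\sum_{m=1}^\infty a_m(L)\,m^{-s}.$$ Then both $\zeta_L^+(s)$ and $\zeta_L(s)$ can be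 continued meromorphically to $\{s\in\mathbb{C}:\operatorname{Re}(s)>1\}$. In that region each has a simple pole at $s=2$ and no other pole. Moreover, the abscissa of convergence of each of the two Dirichlet series equals $2$. -/

import Mathlib

open Filter Topology

namespace SublatticeZeta

section QuadraticSpace

variable {V : Type*} [AddCommGroup V] [Module ℚ V]

/-- The symmetric bilinear form `B` of the quadratic space `(V, Q)`, normalised by
`2 B(x, y) = Q(x + y) - Q(x) - Q(y)`. -/
noncomputable def bilin (Q : QuadraticForm ℚ V) (x y : V) : ℚ :=
  QuadraticMap.associated (R := ℚ) Q x y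

/-- The orthogonal group `O(V)`: all `σ ∈ GL(V)` with `B(σ x, σ y) = B(x, y)`. -/
noncomputable def orthogonal (Q : QuadraticForm ℚ V) : Subgroup (V ≃ₗ[ℚ] V) where
  carrier := {σ | ∀ x y : V, bilin Q (σ x) (σ y) = bilin Q x y}
  mul_mem' := by
    intro σ τ hσ hτ x y
    exact (hσ (τ x) (τ y)).trans (hτ x y)
  one_mem' := fun _ _ => rfl
  inv_mem' := by
    intro σ hσ x y
    have h := hσ (σ⁻¹ x) (σ⁻¹ y)
    have hx : ∀ z : V, σ (σ⁻¹ z) = z := fun z => LinearEquiv.apply_symm_apply σ z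
    rw [hx, hx] at h
    exact h.symm

/-- The special orthogonal group `O⁺(V) = O(V) ∩ SL(V)`. -/
noncomputable def specialOrthogonal (Q : QuadraticForm ℚ V) : Subgroup (V ≃ₗ[ℚ] V) :=
  orthogonal Q ⊓ (LinearEquiv.det (R := ℚ) (M := V)).ker

/-- The Gram matrix `(B(e i, e j))` of a `ℤ`-lattice with respect to a `ℤ`-basis `e`. -/
noncomputable def gramMatrix (Q : QuadraticForm ℚ V) {L : Submodule ℤ V} {ι : Type*}
    (e : Module.Basis ι ℤ L) : Matrix ι ι ℚ :=
  Matrix.of fun i j => bilin Q (e i : V) (e j : V)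

/-- The image `σ(K)` of a `ℤ`-submodule `K` of `V` under `σ ∈ GL(V)`. -/
def image (σ : V ≃ₗ[ℚ] V) (K : Submodule ℤ V) : Submodule ℤ V :=
  K.map ((σ : V →ₗ[ℚ] V).restrictScalars ℤ)

/-- The set of all `ℤ`-sublattices of `L` of index `m` (used for `m ≥ 1`). -/
def sublattices (L : Submodule ℤ V) (m : ℕ) : Set (Submodule ℤ V) :=
  {K | K ≤ L ∧ K.toAddSubgroup.relIndex L.toAddSubgroup = m}

/-- The class of `K` under a group `G` of automorphisms of `V`: all `σ(K)` with `σ ∈ G`. -/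
def cls (G : Subgroup (V ≃ₗ[ℚ] V)) (K : Submodule ℤ V) : Set (Submodule ℤ V) :=
  {K' | ∃ σ ∈ G, image σ K = K'}

/-- `a_m⁺(L)`: the number of classes under `O⁺(V)` of sublattices of `L` of index `m`. -/
noncomputable def properCount (Q : QuadraticForm ℚ V) (L : Submodule ℤ V) (m : ℕ) : ℕ :=
  (cls (specialOrthogonal Q) '' sublattices L m).ncard

/-- `a_m(L)`: the number of classes under `O(V)` of sublattices of `L` of index `m`. -/
noncomputable def count (Q : QuadraticForm ℚ V) (L : Submodule ℤ V) (m : ℕ) : ℕ :=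
  (cls (orthogonal Q) '' sublattices L m).ncard

end QuadraticSpace

/-- The Dirichlet series `∑_{m ≥ 1} a m * m ^ (-s)` converges, as the limit of its partial sums.
(`LSeries.term a s 0 = 0`.) -/
def DirichletConverges (a : ℕ → ℂ) (s : ℂ) : Prop :=
  ∃ l : ℂ, Tendsto (fun N : ℕ => ∑ m ∈ Finset.range N, LSeries.term a s m) atTop (𝓝 l)

/-- The abscissa of convergence of `∑_{m ≥ 1} a m * m ^ (-s)`: the infimum of the real `x` such
that the series converges at every `s` with `Re s > x`. -/
noncomputable def abscissaOfConvergence (a : ℕ → ℂ) : EReal :=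
  sInf (Real.toEReal '' {x : ℝ | ∀ s : ℂ, x < s.re → DirichletConverges a s})

section Zeta

variable {V : Type*} [AddCommGroup V] [Module ℚ V]

/-- The coefficients of the zeta function of proper isometry classes of `L`. -/
noncomputable def properCoeff (Q : QuadraticForm ℚ V) (L : Submodule ℤ V) (m : ℕ) : ℂ :=
  (properCount Q L m : ℂ)

/-- The coefficients of the zeta function of isometry classes of `L`. -/
noncomputable def coeff (Q : QuadraticForm ℚ V) (L : Submodule ℤ V) (m : ℕ) : ℂ :=
  (count Q L m : ℂ)

/-- The zeta function of proper isometry classes, `ζ_L⁺(s) = ∑_{m ≥ 1} a_m⁺(L) m^{-s}`. -/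
noncomputable def properZeta (Q : QuadraticForm ℚ V) (L : Submodule ℤ V) (s : ℂ) : ℂ :=
  LSeries (properCoeff Q L) s

/-- The zeta function of isometry classes, `ζ_L(s) = ∑_{m ≥ 1} a_m(L) m^{-s}`. -/
noncomputable def zeta (Q : QuadraticForm ℚ V) (L : Submodule ℤ V) (s : ℂ) : ℂ :=
  LSeries (coeff Q L) s

end Zeta

end SublatticeZeta

namespace SublatticeZeta

/-! ### Continuation and abscissa of a Dirichlet series built by convolution -/

section DirichletSeries

open scoped LSeries.notation
open scoped ComplexOrder

/-! The discriminant hypothesis makes `L` similar to a nonzero ideal `I` of the ring of integers of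
the imaginary quadratic field `F`, with its norm form (`exists_realization`). Isometries become
norm-preserving ℚ-linear maps of `F`, and each of these is a field automorphism followed by
multiplication by an element of norm one (`exists_eq_mul_algEquiv`). Hence they respect the
operation of passing from a sublattice to the ideal that it generates.

Sort the sublattices `K` of `I` by this ideal, `J = a * I`: if `K` has index `m` in `I` and index
`f` in `J`, then `m = N(a) f`. The number `ψ(f)` of sublattices of index `f` that generate `J` does
not depend on `J` (`ncard_primitiveSubgroups`). Since ℤ² has `σ₁(m)` subgroups of index `m`, this
gives `ζ_F(s) ∑ ψ(f) f⁻ˢ = ζ(s) ζ(s - 1)`.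

Now count classes. Ideals of equal norm in the same ideal class are equivalent, so each norm `n`
contributes at most `h` classes of ideals, where `h` is the class number of `F`. Two sublattices
generating the same `J` are equivalent exactly when the stabilizer `S` of `J`, a finite group,
relates them. In Burnside's formula for `S` the elements `±1` contribute `2 ψ(f) / |S|`. Every other
element fixes only `O(d(f))` sublattices: a rotation fixes none once `f` is large, and a reflection
fixes at most `2 d(f)` (`exists_ncard_fixedPrimitive_le`).

So the coefficients are `α ⍟ ψ + β`, with `α ≥ 0` bounded, `α 1 > 0`, and `β` dominated by the
coefficients of a multiple of `ζ(s)³`. The continuation is `A(s) ζ(s) ζ(s - 1) / ζ_F(s) + B(s)`,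
where `A` and `B` are the series of `α` and `β`. For `Re s > 1` the functions `A` and `B` are
holomorphic and `ζ_F` has no zero (its inverse is the Möbius series over ideals), so the only pole
is that of `ζ(s - 1)`. It survives because `A(2) ζ(2) ≠ 0`. As the coefficients are nonnegative,
convergence to the left of `2` would be absolute and would contradict the pole. -/

theorem term_natCast_eq (s : ℂ) (n : ℕ) :
    LSeries.term (fun n : ℕ => (n : ℂ)) s n = LSeries.term 1 (s - 1) n := by
  rcases eq_or_ne n 0 with rfl | hn
  · simp
  · have hn' : (n : ℂ) ≠ 0 := by exact_mod_cast hn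
    rw [LSeries.term_of_ne_zero hn, LSeries.term_of_ne_zero hn, Complex.cpow_sub _ _ hn',
      Complex.cpow_one]
    simp

theorem LSeries_natCast {s : ℂ} (hs : 2 < s.re) :
    LSeries (fun n : ℕ => (n : ℂ)) s = riemannZeta (s - 1) := by
  rw [← LSeries_one_eq_riemannZeta (by simp; linarith)]
  exact tsum_congr (term_natCast_eq s)

theorem abscissaOfAbsConv_natCast_le :
    LSeries.abscissaOfAbsConv (fun n : ℕ => (n : ℂ)) ≤ 2 := by
  refine LSeries.abscissaOfAbsConv_le_of_forall_lt_LSeriesSummable' fun y hy => ?_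
  have hy : (2 : ℝ) < y := EReal.coe_lt_coe_iff.1 hy
  have h : LSeriesSummable 1 ((y : ℂ) - 1) := LSeriesSummable_one_iff.2 (by simp; linarith)
  exact h.congr fun n => (term_natCast_eq _ n).symm

/-- The arithmetic data behind the analytic continuation: coefficients `a = α ⍟ ψ + β` with
`α`, `β` of abscissa at most `1` and `ι ⍟ ψ = σ₁`. -/
structure ZetaDecomposition (a : ℕ → ℂ) (α ψ β ι : ℕ → ℂ) : Prop where
  nonneg : 0 ≤ a
  eq : ∀ m ≠ 0, a m = (α ⍟ ψ) m + β m
  alpha_nonneg : 0 ≤ α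
  alpha_one : 0 < α 1
  alpha_conv : LSeries.abscissaOfAbsConv α ≤ 1
  beta_conv : LSeries.abscissaOfAbsConv β ≤ 1
  iota_conv : LSeries.abscissaOfAbsConv ι ≤ 1
  iota_ne : ∀ s : ℂ, 1 < s.re → LSeries ι s ≠ 0
  psi_conv : LSeries.abscissaOfAbsConv ψ ≤ 2
  conv_eq : ∀ m ≠ 0, (ι ⍟ ψ) m = ((∑ d ∈ m.divisors, d : ℕ) : ℂ)

namespace ZetaDecomposition

variable {a α ψ β ι : ℕ → ℂ}

theorem lt_re_of_le {f : ℕ → ℂ} {x : ℝ} (hf : LSeries.abscissaOfAbsConv f ≤ x) {s : ℂ}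
    (hs : x < s.re) : LSeries.abscissaOfAbsConv f < s.re :=
  hf.trans_lt (by exact_mod_cast hs)

/-- Both sides are the Dirichlet series of `σ₁ = 1 ⍟ id`. -/
theorem LSeries_iota_mul_psi (h : ZetaDecomposition a α ψ β ι) {s : ℂ} (hs : 2 < s.re) :
    LSeries ι s * LSeries ψ s = riemannZeta s * riemannZeta (s - 1) := by
  have h1 : (1 : ℝ) < s.re := by linarith
  rw [← LSeries_convolution (lt_re_of_le (x := 1) (mod_cast h.iota_conv) h1)
    (lt_re_of_le (x := 2) (mod_cast h.psi_conv) hs),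
    ← LSeries_natCast hs, ← LSeries_one_eq_riemannZeta h1,
    ← LSeries_convolution (lt_re_of_le (x := 1) LSeries.abscissaOfAbsConv_one.le h1)
      (lt_re_of_le (x := 2) (mod_cast abscissaOfAbsConv_natCast_le) hs)]
  refine LSeries_congr (fun {m} hm => ?_) s
  rw [h.conv_eq m hm, LSeries.convolution_def]
  simp only [Pi.one_apply, one_mul]
  rw [Nat.sum_divisorsAntidiagonal' (f := fun _ y => (y : ℂ))]
  push_cast
  rfl

/-- The continuation of the Dirichlet series with coefficients `a` to `1 < Re s`. -/
noncomputable def continuation (α β ι : ℕ → ℂ) (s : ℂ) : ℂ :=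
  LSeries α s * (riemannZeta s * riemannZeta (s - 1) / LSeries ι s) + LSeries β s

/-- To the right of `2` the series of `ψ` converges and equals the quotient `ζ(s) ζ(s - 1) / ι(s)`
that replaces it in `continuation`. -/
theorem summable_and_eq (h : ZetaDecomposition a α ψ β ι) {s : ℂ} (hs : 2 < s.re) :
    LSeriesSummable a s ∧ continuation α β ι s = LSeries a s := by
  have h1 : (1 : ℝ) < s.re := by linarith
  have hα := lt_re_of_le (x := 1) (mod_cast h.alpha_conv) h1
  have hψ := lt_re_of_le (x := 2) (mod_cast h.psi_conv) hs
  have hβ := lt_re_of_le (x := 1) (mod_cast h.beta_conv) h1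
  have s1 : LSeriesSummable (α ⍟ ψ) s :=
    (LSeriesSummable_of_abscissaOfAbsConv_lt_re hα).convolution
      (LSeriesSummable_of_abscissaOfAbsConv_lt_re hψ)
  have s2 := LSeriesSummable_of_abscissaOfAbsConv_lt_re hβ
  have he : ∀ {m : ℕ}, m ≠ 0 → ((α ⍟ ψ) + β) m = a m := fun {m} hm => (h.eq m hm).symm
  refine ⟨(LSeriesSummable_congr s he).1 (s1.add s2), ?_⟩
  rw [← LSeries_congr he s, LSeries_add s1 s2, LSeries_convolution hα hψ, continuation,
    ← h.LSeries_iota_mul_psi hs, mul_div_cancel_left₀ _ (h.iota_ne s h1)]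

theorem analyticAt_LSeries {f : ℕ → ℂ} (hf : LSeries.abscissaOfAbsConv f ≤ 1) {s : ℂ}
    (hs : 1 < s.re) : AnalyticAt ℂ (LSeries f) s :=
  LSeries_analyticOnNhd f s (lt_re_of_le (x := 1) (mod_cast hf) hs)

theorem analyticAt_riemannZeta {s : ℂ} (hs : s ≠ 1) : AnalyticAt ℂ riemannZeta s := by
  refine Complex.analyticAt_iff_eventually_differentiableAt.2 ?_
  filter_upwards [isOpen_ne.mem_nhds hs] with z hz using differentiableAt_riemannZeta hz

/-- The singularity of `(s - 1) ζ(s)` at `1` is removable, and the residue of `ζ` gives the value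
there. -/
theorem exists_analyticAt_riemannZeta_one :
    ∃ g : ℂ → ℂ, AnalyticAt ℂ g 1 ∧ g 1 = 1 ∧ ∀ z ≠ 1, riemannZeta z = (z - 1)⁻¹ * g z := by
  refine ⟨Function.update (fun s => (s - 1) * riemannZeta s) 1 1, ?_, by simp, fun z hz => ?_⟩
  · refine Complex.analyticAt_of_differentiable_on_punctured_nhds_of_continuousAt ?_ ?_
    · filter_upwards [self_mem_nhdsWithin] with z hz
      have hd : DifferentiableAt ℂ (fun s => (s - 1) * riemannZeta s) z :=
        (by fun_prop : DifferentiableAt ℂ (fun s : ℂ => s - 1) z).mul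
          (differentiableAt_riemannZeta hz)
      refine hd.congr_of_eventuallyEq ?_
      filter_upwards [isOpen_ne.mem_nhds hz] with w hw
      exact Function.update_of_ne hw _ _
    · exact continuousAt_update_same.2 riemannZeta_residue_one
  · rw [Function.update_of_ne hz, inv_mul_cancel_left₀ (sub_ne_zero.2 hz)]

theorem analyticAt_continuation (h : ZetaDecomposition a α ψ β ι) {s : ℂ} (hs : 1 < s.re)
    (h2 : s ≠ 2) : AnalyticAt ℂ (continuation α β ι) s := by
  have hs1 : s ≠ 1 := by rintro rfl; simp at hs
  have hz : AnalyticAt ℂ (fun s => riemannZeta (s - 1)) s := by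
    have : AnalyticAt ℂ riemannZeta (s - 1) :=
      analyticAt_riemannZeta fun h => h2 (by linear_combination h)
    exact this.comp (f := fun s : ℂ => s - 1) (by fun_prop)
  exact ((analyticAt_LSeries h.alpha_conv hs).mul
    (((analyticAt_riemannZeta hs1).mul hz).div (analyticAt_LSeries h.iota_conv hs)
      (h.iota_ne s hs))).add (analyticAt_LSeries h.beta_conv hs)

/-- The leading coefficient is `α(2) ζ(2) / ι(2)`, where `α(2) > 0` because the coefficients `α` are
nonnegative and `α 1 > 0`. -/
theorem exists_analyticAt_continuation_two (h : ZetaDecomposition a α ψ β ι) :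
    ∃ g : ℂ → ℂ, AnalyticAt ℂ g 2 ∧ g 2 ≠ 0 ∧
      ∀ z ≠ 2, continuation α β ι z = (z - 2) ^ (-1 : ℤ) • g z := by
  obtain ⟨r, hr, hr1, hrz⟩ := exists_analyticAt_riemannZeta_one
  have h2 : (1 : ℝ) < (2 : ℂ).re := by norm_num
  have hr' : AnalyticAt ℂ (fun s => r (s - 1)) 2 := by
    have : AnalyticAt ℂ r (2 - 1) := by norm_num; exact hr
    exact this.comp (f := fun s : ℂ => s - 1) (by fun_prop)
  refine ⟨fun s => LSeries α s * (riemannZeta s * r (s - 1) / LSeries ι s)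
    + (s - 2) * LSeries β s, ?_, ?_, ?_⟩
  · exact ((analyticAt_LSeries h.alpha_conv h2).mul
      (((analyticAt_riemannZeta (by norm_num)).mul hr').div (analyticAt_LSeries h.iota_conv h2)
      (h.iota_ne 2 h2))).add
        ((by fun_prop : AnalyticAt ℂ (fun s : ℂ => s - 2) 2).mul
          (analyticAt_LSeries h.beta_conv h2))
  · have hpos : 0 < LSeries α (2 : ℝ) :=
      LSeries.positive h.alpha_nonneg h.alpha_one
        (lt_of_le_of_lt h.alpha_conv (by norm_cast))
    have e1 : (2 : ℂ) - 1 = 1 := by norm_num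
    have hζ : riemannZeta 2 ≠ 0 := riemannZeta_ne_zero_of_one_lt_re h2
    simp only [e1, hr1, sub_self, zero_mul, add_zero, mul_one]
    exact mul_ne_zero (by simpa using hpos.ne') (div_ne_zero hζ (h.iota_ne 2 h2))
  · intro z hz
    have hz' : z - 2 ≠ 0 := sub_ne_zero.2 hz
    have e : z - 1 - 1 = z - 2 := by ring
    rw [continuation, hrz (z - 1) (fun h => hz (by linear_combination h)), e, zpow_neg_one,
      smul_eq_mul]
    field_simp

theorem meromorphicAt_continuation_two (h : ZetaDecomposition a α ψ β ι) :
    MeromorphicAt (continuation α β ι) 2 := by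
  obtain ⟨g, hg, -, hgz⟩ := h.exists_analyticAt_continuation_two
  have : MeromorphicAt (fun z : ℂ => (z - 2) ^ (-1 : ℤ) • g z) 2 :=
    ((by fun_prop : AnalyticAt ℂ (fun s : ℂ => s - 2) 2).meromorphicAt.zpow _).smul
      hg.meromorphicAt
  refine this.congr ?_
  filter_upwards [self_mem_nhdsWithin] with z hz using (hgz z hz).symm

theorem meromorphicOrderAt_continuation (h : ZetaDecomposition a α ψ β ι) :
    meromorphicOrderAt (continuation α β ι) 2 = -1 := by
  obtain ⟨g, hg, hg0, hgz⟩ := h.exists_analyticAt_continuation_two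
  refine (meromorphicOrderAt_eq_int_iff (n := -1) h.meromorphicAt_continuation_two).2
    ⟨g, hg, hg0, ?_⟩
  filter_upwards [self_mem_nhdsWithin] with z hz using hgz z hz

theorem meromorphicOn_continuation (h : ZetaDecomposition a α ψ β ι) :
    MeromorphicOn (continuation α β ι) {s : ℂ | 1 < s.re} := by
  intro s hs
  rcases eq_or_ne s 2 with rfl | h2
  · exact h.meromorphicAt_continuation_two
  · exact (h.analyticAt_continuation hs h2).meromorphicAt

/-- Convergence at a real point of a Dirichlet series with nonnegative coefficients is absolute. -/
theorem LSeriesSummable_of_dirichletConverges (ha : 0 ≤ a) {x : ℝ}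
    (hx : DirichletConverges a x) : LSeriesSummable a x := by
  obtain ⟨l, hl⟩ := hx
  have hnn : ∀ n, 0 ≤ LSeries.term a x n := fun n => LSeries.term_nonneg (ha n) x
  have hre : ∀ n, ((LSeries.term a x n).re : ℂ) = LSeries.term a x n := fun n =>
    (Complex.eq_re_of_ofReal_le (r := 0) (by simpa using hnn n)).symm
  have hs : Summable fun n => (LSeries.term a x n).re := by
    have ht : Tendsto (fun N : ℕ => ∑ m ∈ Finset.range N, (LSeries.term a x m).re) atTop
        (𝓝 l.re) := by
      have := (Complex.continuous_re.tendsto l).comp hl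
      refine this.congr fun N => ?_
      simp
    exact ((hasSum_iff_tendsto_nat_of_nonneg (fun n => (Complex.nonneg_iff.1 (hnn n)).1) _).2
      ht).summable
  have := Complex.ofRealCLM.summable hs
  exact this.congr hre

/-- Absolute convergence to the left of `2` would make the series continuous at `2`, yet along `2 +
1 / (n + 1)` it equals the continuation, which is unbounded. -/
theorem not_LSeriesSummable (h : ZetaDecomposition a α ψ β ι) {x : ℝ} (hx : x < 2) :
    ¬ LSeriesSummable a x := by
  intro hs
  have hab : LSeries.abscissaOfAbsConv a < ((2 : ℂ).re : EReal) :=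
    hs.abscissaOfAbsConv_le.trans_lt (by simpa using hx)
  have hc : ContinuousAt (LSeries a) 2 := (LSeries_analyticOnNhd a 2 hab).continuousAt
  have hco := tendsto_cobounded_of_meromorphicOrderAt_neg (f := continuation α β ι) (x := 2)
    (by rw [h.meromorphicOrderAt_continuation]; decide)
  have hu : Tendsto (fun n : ℕ => (2 : ℂ) + ((1 / ((n : ℝ) + 1) : ℝ) : ℂ)) atTop (𝓝[≠] 2) := by
    refine tendsto_nhdsWithin_iff.2 ⟨?_, Eventually.of_forall fun n => ?_⟩
    · have h0 := (Complex.continuous_ofReal.tendsto 0).comp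
        (tendsto_one_div_add_atTop_nhds_zero_nat (𝕜 := ℝ))
      have := (tendsto_const_nhds (x := (2 : ℂ))).add h0
      simpa only [Complex.ofReal_zero, add_zero, Function.comp_def] using this
    · have : (1 / ((n : ℝ) + 1)) ≠ 0 := by positivity
      simpa using (Complex.ofReal_ne_zero.2 this)
  have t1 := hco.comp hu
  have t2 := hc.tendsto.comp (hu.mono_right nhdsWithin_le_nhds)
  have heq : (continuation α β ι ∘ fun n : ℕ => (2 : ℂ) + ((1 / ((n : ℝ) + 1) : ℝ) : ℂ)) =
      (LSeries a ∘ fun n : ℕ => (2 : ℂ) + ((1 / ((n : ℝ) + 1) : ℝ) : ℂ)) := by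
    funext n
    refine (h.summable_and_eq ?_).2
    have : (0 : ℝ) < 1 / ((n : ℝ) + 1) := by positivity
    rw [Complex.add_re, Complex.ofReal_re]
    simpa using this
  rw [heq] at t1
  exact t2.not_tendsto (Metric.disjoint_nhds_cobounded _) t1

theorem abscissaOfConvergence_eq (h : ZetaDecomposition a α ψ β ι) :
    abscissaOfConvergence a = 2 := by
  refine IsLeast.csInf_eq ⟨⟨2, fun s hs => ?_, by norm_cast⟩, ?_⟩
  · exact ⟨_, (h.summable_and_eq hs).1.hasSum.tendsto_sum_nat⟩
  · rintro _ ⟨x, hx, rfl⟩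
    by_contra hlt
    have hx2 : x < 2 := EReal.coe_lt_coe_iff.1 (not_le.1 hlt)
    -- Convergence is known only strictly to the right of `x`, hence the intermediate point `y`.
    obtain ⟨y, hxy, hy2⟩ := exists_between hx2
    exact h.not_LSeriesSummable hy2
      (LSeriesSummable_of_dirichletConverges h.nonneg (hx y (by simpa using hxy)))

end ZetaDecomposition

end DirichletSeries

open NumberField

/-! ### Counting ideals by norm, and nonvanishing of the Dedekind zeta function -/

section MoebiusInversion

open scoped LSeries.notation
open scoped ComplexOrder

section Moebius

open UniqueFactorizationMonoid

variable {α : Type*} [CommMonoidWithZero α] [UniqueFactorizationMonoid α]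

/-- The Moebius function sums to zero over the divisors of a nonzero nonunit. -/
theorem sum_moebius_dvd [Subsingleton αˣ] {c : α} (hc : c ≠ 0) (hc1 : ¬ IsUnit c) (s : Finset α)
    (hs : ∀ a, a ∈ s ↔ a ∣ c) : ∑ a ∈ s, moebius a = 0 := by
  classical
  obtain ⟨p, hp, hpc⟩ := WfDvdMonoid.exists_irreducible_factor hc1 hc
  rw [← Finset.sum_filter_of_ne (p := fun a : α => Squarefree a)
    (fun a _ h => by by_contra hn; exact h (moebius_of_not_squarefree hn))]
  have hmul : ∀ a, ¬ p ∣ a → moebius (p * a) = - moebius a := fun a ha => by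
    rw [(hp.isRelPrime_iff_not_dvd.2 ha).moebius_mul, hp.moebius_eq, neg_one_mul]
  have hdiv : ∀ b, Squarefree (p * b) → ¬ p ∣ b := by
    rintro _ hsq ⟨d, rfl⟩
    exact hp.not_isUnit (hsq p ⟨d, by rw [mul_assoc]⟩)
  -- Pair the squarefree divisors through `a ↔ p * a`, for a fixed irreducible `p ∣ c`; the two
  -- members of a pair have opposite Möbius values.
  refine Finset.sum_involution
    (fun a _ => if h : p ∣ a then Classical.choose h else p * a) ?_ ?_ ?_ ?_
  · intro a ha
    rw [Finset.mem_filter] at ha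
    split_ifs with h
    · have e := Classical.choose_spec h
      have := hmul _ (hdiv _ (e ▸ ha.2))
      rw [← e] at this
      rw [this, neg_add_cancel]
    · rw [hmul a h, add_neg_cancel]
  · intro a ha _
    rw [Finset.mem_filter] at ha
    split_ifs with h
    · have e := Classical.choose_spec h
      intro heq
      exact hdiv _ (e ▸ ha.2) (heq.symm ▸ h)
    · intro heq
      exact h (heq ▸ dvd_mul_right p a)
  · intro a ha
    rw [Finset.mem_filter, hs] at ha ⊢
    split_ifs with h
    · have e := Classical.choose_spec h
      have hd : Classical.choose h ∣ a := by conv_rhs => rw [e]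
                                             exact dvd_mul_left _ _
      exact ⟨hd.trans ha.1, ha.2.squarefree_of_dvd hd⟩
    · have hr := hp.isRelPrime_iff_not_dvd.2 h
      exact ⟨hr.mul_dvd hpc ha.1, squarefree_mul_iff.2 ⟨hr, hp.squarefree, ha.2⟩⟩
  · intro a ha
    rw [Finset.mem_filter] at ha
    by_cases h : p ∣ a
    · have e := Classical.choose_spec h
      have hn := hdiv _ (e ▸ ha.2)
      simp only [h, dite_true, hn, dite_false]
      exact e.symm
    · have hd : p ∣ p * a := dvd_mul_right p a
      simp only [h, dite_false, hd, dite_true]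
      exact (mul_left_cancel₀ hp.ne_zero (Classical.choose_spec hd)).symm

end Moebius

section Ideals

variable (F : Type*) [Field F] [NumberField F]

/-- The integral ideals of norm `n`. -/
noncomputable def idealsOfNorm (n : ℕ) : Finset (Ideal (𝓞 F)) :=
  (Ideal.finite_setOfPred_absNorm_eq n).toFinset

variable {F} in
@[simp]
theorem mem_idealsOfNorm {n : ℕ} {a : Ideal (𝓞 F)} :
    a ∈ idealsOfNorm F n ↔ Ideal.absNorm a = n := by
  simp [idealsOfNorm]

/-- The number of integral ideals of norm `n`. -/
noncomputable def idealCount (n : ℕ) : ℕ := (idealsOfNorm F n).card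

theorem idealCount_eq (n : ℕ) :
    idealCount F n = Nat.card {I : Ideal (𝓞 F) // Ideal.absNorm I = n} := by
  rw [idealCount, idealsOfNorm, ← Set.ncard_eq_toFinset_card _ _]
  rfl

theorem idealsOfNorm_one : idealsOfNorm F 1 = {⊤} := by
  ext a; simp [Ideal.absNorm_eq_one_iff]

open Asymptotics in
-- The number of nonzero ideals of norm at most `n` is `O(n)`.
theorem LSeriesSummable_idealCount {s : ℂ} (hs : 1 < s.re) :
    LSeriesSummable (fun n => (idealCount F n : ℂ)) s := by
  have h := (Ideal.tendsto_norm_le_div_atTop₀ F).comp tendsto_natCast_atTop_atTop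
  refine (LSeriesSummable_of_sum_norm_bigO_and_nonneg (r := 1)
    (f := fun n => (idealCount F n : ℝ)) ?_ (fun n => Nat.cast_nonneg _) zero_le_one hs)
  have hb := (h.isBigO_one ℝ).mul (isBigO_refl (fun n : ℕ => (n : ℝ) ^ (1 : ℝ)) atTop)
  refine (hb.congr' ?_ ?_)
  · filter_upwards [eventually_ne_atTop 0] with n hn
    have hn' : (n : ℝ) ≠ 0 := by exact_mod_cast hn
    simp only [Function.comp_apply, Nat.cast_le, Real.rpow_one, ← Nat.cast_sum]
    rw [div_mul_cancel₀ _ hn']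
    congr 1
    -- The added `1` is the zero ideal, the only ideal of norm `0`.
    rw [← add_left_inj 1, ← Ideal.card_norm_le_eq_card_norm_le_add_one]
    simp only [idealCount_eq]
    rw [show Finset.Icc 1 n = Finset.Ioc 0 n from Finset.Icc_succ_left_eq_Ioc _ _,
      show 1 = Nat.card {I : Ideal (𝓞 F) // Ideal.absNorm I = 0} by
        simp [Ideal.absNorm_eq_zero_iff],
      Finset.sum_Ioc_add_eq_sum_Icc (n.zero_le),
      ← Finset.card_preimage_eq_sum_card_image_eq
        (fun k _ ↦ Ideal.finite_setOfPred_absNorm_eq k)]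
    simp [Set.coe_eq_subtype]
  · filter_upwards with n
    rw [one_mul]

theorem abscissaOfAbsConv_idealCount :
    LSeries.abscissaOfAbsConv (fun n => (idealCount F n : ℂ)) ≤ 1 :=
  LSeries.abscissaOfAbsConv_le_of_forall_lt_LSeriesSummable' fun y hy =>
    LSeriesSummable_idealCount F (by simpa using EReal.coe_lt_coe_iff.1 hy)

/-- The sum of the Moebius function over the ideals of norm `n`. -/
noncomputable def moebiusSum (n : ℕ) : ℤ :=
  ∑ a ∈ idealsOfNorm F n, UniqueFactorizationMonoid.moebius a

theorem abs_moebiusSum_le (n : ℕ) : |moebiusSum F n| ≤ idealCount F n := by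
  refine (Finset.abs_sum_le_sum_abs _ _).trans ?_
  rw [idealCount, Finset.card_eq_sum_ones, Nat.cast_sum]
  refine Finset.sum_le_sum fun a _ => ?_
  by_cases h : Squarefree a
  · simp [h]
  · simp [h]

open scoped Classical in
/-- Pairs of ideals whose norms multiply to `n` may be summed by their product. -/
theorem sum_divisorsAntidiagonal_idealsOfNorm {M : Type*} [AddCommMonoid M] {n : ℕ} (hn : n ≠ 0)
    (f : Ideal (𝓞 F) → M) :
    ∑ p ∈ n.divisorsAntidiagonal, ∑ a ∈ idealsOfNorm F p.1, ∑ _b ∈ idealsOfNorm F p.2, f a =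
      ∑ c ∈ idealsOfNorm F n,
        ∑ a ∈ (n.divisors.biUnion (idealsOfNorm F)).filter (· ∣ c), f a := by
  classical
  have hne : ∀ {a : Ideal (𝓞 F)} {m : ℕ}, m ≠ 0 → Ideal.absNorm a = m → a ≠ 0 := by
    rintro a m hm rfl h
    exact hm (by rw [h]; simp)
  simp_rw [← Finset.sum_product']
  rw [Finset.sum_sigma', Finset.sum_sigma']
  refine Finset.sum_bij (fun x _ => ⟨x.2.1 * x.2.2, x.2.1⟩) ?_ ?_ ?_ ?_
  · rintro ⟨⟨x, y⟩, a, b⟩ h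
    simp only [Finset.mem_sigma, Nat.mem_divisorsAntidiagonal, Finset.mem_product,
      mem_idealsOfNorm, Finset.mem_filter, Finset.mem_biUnion, Nat.mem_divisors] at h ⊢
    obtain ⟨⟨rfl, -⟩, rfl, rfl⟩ := h
    exact ⟨map_mul _ _ _, ⟨_, ⟨dvd_mul_right _ _, hn⟩, rfl⟩, dvd_mul_right _ _⟩
  · rintro ⟨⟨x, y⟩, a, b⟩ h ⟨⟨x', y'⟩, a', b'⟩ h' e
    simp only [Finset.mem_sigma, Nat.mem_divisorsAntidiagonal, Finset.mem_product,
      mem_idealsOfNorm] at h h'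
    obtain ⟨⟨hxy, -⟩, rfl, rfl⟩ := h
    obtain ⟨⟨-, -⟩, rfl, rfl⟩ := h'
    simp only [Sigma.mk.injEq, heq_eq_eq] at e
    obtain ⟨e, rfl⟩ := e
    have ha : a ≠ 0 := hne (fun h => hn (by rw [← hxy]; simp [h])) rfl
    obtain rfl := mul_left_cancel₀ ha e
    rfl
  · rintro ⟨c, a⟩ h
    simp only [Finset.mem_sigma, mem_idealsOfNorm, Finset.mem_filter, Finset.mem_biUnion,
      Nat.mem_divisors] at h
    obtain ⟨hc, -, b, rfl⟩ := h
    refine ⟨⟨(Ideal.absNorm a, Ideal.absNorm b), (a, b)⟩, ?_, rfl⟩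
    simp [← hc] at hn ⊢
    exact hn
  · rintro ⟨⟨x, y⟩, a, b⟩ _
    rfl

/-- Grouping the pairs `(a, b)` by `c = a * b` leaves the Möbius sum over the divisors of each ideal
`c` of norm `n`, which vanishes unless `c` is the unit ideal. -/
theorem moebiusSum_convolution_idealCount {n : ℕ} (hn : n ≠ 0) :
    ∑ p ∈ n.divisorsAntidiagonal, moebiusSum F p.1 * idealCount F p.2 = if n = 1 then 1 else 0 := by
  classical
  have h := sum_divisorsAntidiagonal_idealsOfNorm F hn
    (fun a => UniqueFactorizationMonoid.moebius a)
  simp only [Finset.sum_const, nsmul_eq_mul] at h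
  have e : ∀ p : ℕ × ℕ, moebiusSum F p.1 * idealCount F p.2 =
      ∑ a ∈ idealsOfNorm F p.1,
        ((idealsOfNorm F p.2).card : ℤ) * UniqueFactorizationMonoid.moebius a := fun p => by
    rw [moebiusSum, idealCount, Finset.sum_mul]
    exact Finset.sum_congr rfl fun _ _ => mul_comm _ _
  simp_rw [e]
  refine h.trans ?_
  have hmem : ∀ c ∈ idealsOfNorm F n, ∀ a,
      a ∈ (n.divisors.biUnion (idealsOfNorm F)).filter (· ∣ c) ↔ a ∣ c := by
    intro c hc a
    simp only [mem_idealsOfNorm, Finset.mem_filter, Finset.mem_biUnion, Nat.mem_divisors,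
      and_iff_right_iff_imp] at hc ⊢
    exact fun hac => ⟨_, ⟨hc ▸ map_dvd Ideal.absNorm hac, hn⟩, rfl⟩
  split_ifs with h1
  · subst h1
    rw [idealsOfNorm_one, Finset.sum_singleton]
    have : (Nat.divisors 1).biUnion (idealsOfNorm F) = {1} := by
      simp [idealsOfNorm_one, Ideal.one_eq_top]
    rw [this, Finset.filter_singleton, if_pos (one_dvd _), Finset.sum_singleton,
      UniqueFactorizationMonoid.moebius_one]
  · refine Finset.sum_eq_zero fun c hc => sum_moebius_dvd ?_ ?_ _ (hmem c hc)
    · rintro rfl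
      simp at hc
      exact hn hc.symm
    · intro hu
      rw [Ideal.isUnit_iff] at hu
      subst hu
      simp at hc
      exact h1 hc.symm

/-- The series of `moebiusSum` converges absolutely here as well and is a multiplicative inverse. -/
theorem LSeries_idealCount_ne_zero {s : ℂ} (hs : 1 < s.re) :
    LSeries (fun n => (idealCount F n : ℂ)) s ≠ 0 := by
  have h1 := LSeriesSummable_idealCount F hs
  have h2 : LSeriesSummable (fun n => (moebiusSum F n : ℂ)) s := by
    refine Summable.of_norm_bounded h1.norm fun n => LSeries.norm_term_le s ?_
    rw [Complex.norm_intCast, Complex.norm_natCast]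
    exact_mod_cast abs_moebiusSum_le F n
  have h := LSeries_convolution' h2 h1
  have e : LSeries ((fun n => (moebiusSum F n : ℂ)) ⍟ (fun n => (idealCount F n : ℂ))) s = 1 := by
    rw [← Pi.one_apply (M := fun _ => ℂ) s, ← LSeries_delta]
    refine LSeries_congr (fun {n} hn => ?_) s
    rw [LSeries.convolution_def]
    have := congrArg (fun z : ℤ => (z : ℂ)) (moebiusSum_convolution_idealCount F hn)
    push_cast at this
    refine this.trans ?_
    simp [LSeries.delta]
  rw [e] at h
  exact right_ne_zero_of_mul (h ▸ one_ne_zero)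

end Ideals

end MoebiusInversion

/-! ### Finite-index subgroups of ℤ² in Hermite normal form -/

section PlaneLattices

/-- The subgroup of `ℤ × ℤ` generated by `(a, t)` and `(0, b)`. -/
def hermite (a b t : ℤ) : AddSubgroup (ℤ × ℤ) where
  carrier := {p | ∃ x k, p.1 = a * x ∧ p.2 = t * x + b * k}
  zero_mem' := ⟨0, 0, by simp, by simp⟩
  add_mem' := by
    rintro p q ⟨x, k, h1, h2⟩ ⟨y, l, h3, h4⟩
    exact ⟨x + y, k + l, by simp [h1, h3, mul_add], by simp [h2, h4]; ring⟩
  neg_mem' := by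
    rintro p ⟨x, k, h1, h2⟩
    exact ⟨-x, -k, by simp [h1], by simp [h2]; ring⟩

theorem mem_hermite {a b t : ℤ} {p : ℤ × ℤ} :
    p ∈ hermite a b t ↔ ∃ x k, p.1 = a * x ∧ p.2 = t * x + b * k := Iff.rfl

/-- Tower law for `K ≤ K ⊔ N ≤ ℤ × ℤ`, with `N` the kernel of the first projection. -/
theorem index_eq_mul (K : AddSubgroup (ℤ × ℤ)) :
    K.index = (K.map (AddMonoidHom.fst ℤ ℤ)).index * (K.comap (AddMonoidHom.inr ℤ ℤ)).index := by
  set N : AddSubgroup (ℤ × ℤ) := (AddMonoidHom.fst ℤ ℤ).ker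
  have h1 : (K ⊔ N).index = (K.map (AddMonoidHom.fst ℤ ℤ)).index := by
    rw [← AddSubgroup.comap_map_eq, AddSubgroup.index_comap_of_surjective _ Prod.fst_surjective]
  have h2 : K.relIndex (K ⊔ N) = (K.comap (AddMonoidHom.inr ℤ ℤ)).index := by
    rw [sup_comm, AddSubgroup.relIndex_sup_right, ← AddSubgroup.relIndex_top_right,
      AddSubgroup.relIndex_comap]
    congr 1
    ext ⟨x, y⟩
    simp only [N, AddSubgroup.mem_map, AddSubgroup.mem_top, true_and, AddMonoidHom.mem_ker]
    simp [eq_comm]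
  rw [← h1, ← h2, mul_comm, AddSubgroup.relIndex_mul_index le_sup_left]

theorem map_fst_hermite (a b t : ℤ) :
    (hermite a b t).map (AddMonoidHom.fst ℤ ℤ) = AddSubgroup.zmultiples a := by
  ext x
  simp only [AddSubgroup.mem_map, mem_hermite, AddMonoidHom.coe_fst, Int.mem_zmultiples_iff]
  constructor
  · rintro ⟨p, ⟨x, k, h1, -⟩, rfl⟩
    exact ⟨x, h1⟩
  · rintro ⟨y, rfl⟩
    exact ⟨(a * y, t * y), ⟨y, 0, rfl, by simp⟩, rfl⟩

theorem comap_inr_hermite {a : ℤ} (ha : a ≠ 0) (b t : ℤ) :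
    (hermite a b t).comap (AddMonoidHom.inr ℤ ℤ) = AddSubgroup.zmultiples b := by
  ext y
  simp only [AddSubgroup.mem_comap, mem_hermite, AddMonoidHom.inr_apply, Int.mem_zmultiples_iff]
  constructor
  · rintro ⟨x, k, h1, h2⟩
    obtain rfl : x = 0 := by simpa [ha] using h1.symm
    exact ⟨k, by simpa using h2⟩
  · rintro ⟨k, rfl⟩
    exact ⟨0, k, by simp, by simp⟩

theorem index_hermite {a : ℤ} (ha : a ≠ 0) (b t : ℤ) :
    (hermite a b t).index = a.natAbs * b.natAbs := by
  rw [index_eq_mul, map_fst_hermite, comap_inr_hermite ha, Int.index_zmultiples,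
    Int.index_zmultiples]

theorem exists_eq_zmultiples_of_index_ne_zero {H : AddSubgroup ℤ} (h : H.index ≠ 0) :
    H = AddSubgroup.zmultiples (H.index : ℤ) := by
  obtain ⟨a, ha⟩ := Int.subgroup_cyclic H
  rw [AddSubgroup.zmultiples_eq_closure] at *
  subst ha
  ext x
  rw [← AddSubgroup.zmultiples_eq_closure, Int.index_zmultiples, Int.mem_zmultiples_iff,
    ← AddSubgroup.zmultiples_eq_closure, Int.mem_zmultiples_iff, Int.natAbs_dvd]

/-- `a` generates the first projection of `K`, `b` generates the vertical section `K ∩ (0 × ℤ)`, and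
`t` is the second coordinate of a lift of `a`, determined modulo `b`. -/
theorem exists_eq_hermite {K : AddSubgroup (ℤ × ℤ)} {m : ℕ} (hm : m ≠ 0) (hK : K.index = m) :
    ∃ p ∈ m.divisorsAntidiagonal, ∃ t ∈ Finset.range p.2, K = hermite p.1 p.2 t := by
  have hi := index_eq_mul K
  set a := (K.map (AddMonoidHom.fst ℤ ℤ)).index with ha
  set b := (K.comap (AddMonoidHom.inr ℤ ℤ)).index with hb
  have hab : a * b ≠ 0 := by rw [← hi, hK]; exact hm
  have ha0 : a ≠ 0 := left_ne_zero_of_mul hab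
  have hb0 : b ≠ 0 := right_ne_zero_of_mul hab
  have hA := exists_eq_zmultiples_of_index_ne_zero ha0
  have hB := exists_eq_zmultiples_of_index_ne_zero hb0
  rw [← ha] at hA
  rw [← hb] at hB
  have hA' : ∀ p ∈ K, (a : ℤ) ∣ p.1 := fun p hp => by
    rw [← Int.mem_zmultiples_iff, ← hA]
    exact ⟨p, hp, rfl⟩
  have hB' : ∀ y : ℤ, ((0, y) : ℤ × ℤ) ∈ K ↔ (b : ℤ) ∣ y := fun y => by
    rw [← Int.mem_zmultiples_iff, ← hB]
    rfl
  obtain ⟨⟨a', t⟩, hat, rfl : a' = (a : ℤ)⟩ :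
      (a : ℤ) ∈ K.map (AddMonoidHom.fst ℤ ℤ) := by
    rw [hA]; exact AddSubgroup.mem_zmultiples _
  have hb0' : (b : ℤ) ≠ 0 := by exact_mod_cast hb0
  have hmod := Int.emod_nonneg t hb0'
  refine ⟨(a, b), by simp [← hi, hK, hm], (t % b).toNat, ?_, ?_⟩
  · rw [Finset.mem_range]
    have := Int.emod_lt_of_pos t (by omega : 0 < (b : ℤ))
    simp only
    omega
  · rw [Int.toNat_of_nonneg hmod]
    have hat' : ((a : ℤ), t % (b : ℤ)) ∈ K := by
      have : ((a : ℤ), t % (b : ℤ)) = ((a : ℤ), t) - (0, b * (t / b)) := by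
        ext <;> simp [Int.emod_def]
      rw [this]
      exact K.sub_mem hat ((hB' _).2 (dvd_mul_right _ _))
    ext ⟨x, y⟩
    rw [mem_hermite]
    constructor
    · intro h
      obtain ⟨u, rfl⟩ := hA' _ h
      have h0 : ((0 : ℤ), y - t % (b : ℤ) * u) ∈ K := by
        have : ((0 : ℤ), y - t % (b : ℤ) * u) = (((a : ℤ) * u, y) : ℤ × ℤ) -
            u • ((a : ℤ), t % (b : ℤ)) := by
          ext <;> simp [mul_comm]
        rw [this]
        exact K.sub_mem h (K.zsmul_mem hat' u)
      obtain ⟨k, hk⟩ := (hB' _).1 h0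
      exact ⟨u, k, rfl, by simp only; linarith⟩
    · rintro ⟨u, k, h1, h2⟩
      simp only at h1 h2
      subst h1 h2
      have : (((a : ℤ) * u, t % (b : ℤ) * u + b * k) : ℤ × ℤ) =
          u • ((a : ℤ), t % (b : ℤ)) + (0, b * k) := by
        ext <;> simp [mul_comm]
      rw [this]
      exact K.add_mem (K.zsmul_mem hat' u) ((hB' _).2 (dvd_mul_right _ _))

/-- Parameters `((a, b), t)`, `a b = m`, `0 ≤ t < b`, of the subgroups of index `m` in `ℤ × ℤ`. -/
def hermiteParams (m : ℕ) : Finset ((_ : ℕ × ℕ) × ℕ) :=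
  m.divisorsAntidiagonal.sigma fun p => Finset.range p.2

theorem hermite_injOn (m : ℕ) :
    Set.InjOn (fun q : (_ : ℕ × ℕ) × ℕ => hermite q.1.1 q.1.2 q.2) (hermiteParams m) := by
  rintro ⟨⟨a, b⟩, t⟩ h ⟨⟨a', b'⟩, t'⟩ h' e
  simp only [hermiteParams, Finset.coe_sigma, Set.mem_sigma_iff, Finset.mem_coe,
    Nat.mem_divisorsAntidiagonal, Finset.mem_range] at h h' e
  have ha : (a : ℤ) ≠ 0 := by
    rintro h0; exact h.1.2 (by rw [← h.1.1, Int.natCast_eq_zero.1 h0, zero_mul])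
  have ha' : (a' : ℤ) ≠ 0 := by
    rintro h0; exact h'.1.2 (by rw [← h'.1.1, Int.natCast_eq_zero.1 h0, zero_mul])
  obtain rfl : a = a' := by
    have := congrArg (fun K => (K.map (AddMonoidHom.fst ℤ ℤ)).index) e
    simpa [map_fst_hermite] using this
  obtain rfl : b = b' := by
    have := congrArg (fun K => (K.comap (AddMonoidHom.inr ℤ ℤ)).index) e
    simpa [comap_inr_hermite ha] using this
  have hm : (((a : ℤ), (t : ℤ)) : ℤ × ℤ) ∈ hermite a b t' := by
    rw [← e]; exact ⟨1, 0, by simp, by simp⟩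
  obtain ⟨x, k, h1, h2⟩ := hm
  obtain rfl : x = 1 := by
    have : (a : ℤ) * 1 = a * x := by simpa using h1
    exact (mul_left_cancel₀ ha this).symm
  have hmod : t ≡ t' [MOD b] := by
    rw [← Int.natCast_modEq_iff]
    simp only at h2
    exact (Int.modEq_iff_dvd.2 ⟨-k, by linarith⟩)
  obtain rfl : t = t' := Nat.ModEq.eq_of_lt_of_lt hmod h.2 h'.2
  rfl

theorem setOf_index_eq {m : ℕ} (hm : m ≠ 0) :
    {K : AddSubgroup (ℤ × ℤ) | K.index = m} =
      (fun q : (_ : ℕ × ℕ) × ℕ => hermite q.1.1 q.1.2 q.2) '' hermiteParams m := by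
  ext K
  constructor
  · intro hK
    obtain ⟨p, hp, t, ht, rfl⟩ := exists_eq_hermite hm hK
    exact ⟨⟨p, t⟩, Finset.mem_sigma.2 ⟨hp, ht⟩, rfl⟩
  · rintro ⟨⟨⟨a, b⟩, t⟩, h, rfl⟩
    simp only [hermiteParams, Finset.coe_sigma, Set.mem_sigma_iff, Finset.mem_coe,
      Nat.mem_divisorsAntidiagonal, Finset.mem_range] at h
    have ha : (a : ℤ) ≠ 0 := by
      rintro h0; exact h.1.2 (by rw [← h.1.1, Int.natCast_eq_zero.1 h0, zero_mul])
    simp [index_hermite ha, h.1.1]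

theorem finite_setOf_index_eq {m : ℕ} (hm : m ≠ 0) :
    {K : AddSubgroup (ℤ × ℤ) | K.index = m}.Finite := by
  rw [setOf_index_eq hm]
  exact (Finset.finite_toSet _).image _

theorem ncard_setOf_index_eq {m : ℕ} (hm : m ≠ 0) :
    {K : AddSubgroup (ℤ × ℤ) | K.index = m}.ncard = ∑ d ∈ m.divisors, d := by
  rw [setOf_index_eq hm, (hermite_injOn m).ncard_image, Set.ncard_coe_finset, hermiteParams,
    Finset.card_sigma]
  simp only [Finset.card_range]
  rw [Nat.sum_divisorsAntidiagonal' (f := fun _ y => y)]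

theorem card_filter_two_mul_le (b : ℕ) (c : ℤ) :
    ((Finset.range b).filter fun t : ℕ => (b : ℤ) ∣ 2 * t - c).card ≤ 2 := by
  rcases Nat.eq_zero_or_pos b with rfl | hb
  · simp
  have hsub : ((Finset.range b).filter fun t : ℕ => (b : ℤ) ∣ 2 * t - c) ⊆
      -- For `0 ≤ t < b` the number `2 t - c % b` lies strictly between `-b` and `2 b`, so if
      -- divisible by `b` it is `0` or `b`.
      {(c % b).toNat / 2, ((c % b).toNat + b) / 2} := by
    intro t ht
    simp only [Finset.mem_filter, Finset.mem_range, Finset.mem_insert,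
      Finset.mem_singleton] at ht ⊢
    obtain ⟨h1, k, hk⟩ := ht
    have hb' : (0 : ℤ) < b := by exact_mod_cast hb
    have h3 := Int.emod_nonneg c hb'.ne'
    have h4 := Int.emod_lt_of_pos c hb'
    have h5 := Int.emod_add_mul_ediv c b
    have h6 : (2 * t : ℤ) - c % b = b * (k + c / b) := by linarith
    have h7 : k + c / b < 2 := by
      by_contra hcon
      have : (b : ℤ) * 2 ≤ b * (k + c / b) := by gcongr; omega
      omega
    have h8 : -1 < k + c / b := by
      by_contra hcon
      have : (b : ℤ) * (k + c / b) ≤ b * (-1) := by gcongr; omega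
      omega
    have h9 : k + c / b = 0 ∨ k + c / b = 1 := by omega
    rcases h9 with h9 | h9 <;> rw [h9] at h6 <;> omega
  exact (Finset.card_le_card hsub).trans Finset.card_le_two

/-- The subgroups of index `m` stable under `(x, y) ↦ (x, k x - y)` are few. -/
theorem ncard_setOf_index_eq_and_stable_le {m : ℕ} (hm : m ≠ 0) (k : ℤ) :
    {K : AddSubgroup (ℤ × ℤ) | K.index = m ∧ ∀ p ∈ K, (p.1, k * p.1 - p.2) ∈ K}.ncard
      ≤ 2 * m.divisors.card := by
  classical
  set s : Finset ((_ : ℕ × ℕ) × ℕ) := m.divisorsAntidiagonal.sigma fun p =>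
    (Finset.range p.2).filter fun t : ℕ => (p.2 : ℤ) ∣ 2 * t - k * p.1
  have hsub : {K : AddSubgroup (ℤ × ℤ) | K.index = m ∧ ∀ p ∈ K, (p.1, k * p.1 - p.2) ∈ K} ⊆
      (s.image fun q : (_ : ℕ × ℕ) × ℕ => hermite q.1.1 q.1.2 q.2 : Finset _) := by
    rintro K ⟨hK, hst⟩
    obtain ⟨⟨a, b⟩, hp, t, ht, rfl⟩ := exists_eq_hermite hm hK
    rw [Finset.coe_image]
    refine ⟨⟨(a, b), t⟩, ?_, rfl⟩
    simp only [s, Finset.mem_coe, Finset.mem_sigma, Finset.mem_filter]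
    refine ⟨hp, ht, ?_⟩
    have ha : (a : ℤ) ≠ 0 := by
      rw [Nat.mem_divisorsAntidiagonal] at hp
      rintro h0; exact hp.2 (by rw [← hp.1, Int.natCast_eq_zero.1 h0, zero_mul])
    have h1 : (((a : ℤ), (t : ℤ)) : ℤ × ℤ) ∈ hermite a b t := ⟨1, 0, by simp, by simp⟩
    -- Stability applied to the generator `(a, t)` puts `(a, k a - t)` in the subgroup, which forces
    -- `b ∣ 2 t - k a`: at most two values of `t` for each pair `(a, b)`.
    obtain ⟨x, l, hx, hl⟩ := hst _ h1
    obtain rfl : x = 1 := by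
      have : (a : ℤ) * 1 = a * x := by simpa using hx
      exact (mul_left_cancel₀ ha this).symm
    simp only at hl
    exact ⟨-l, by linarith⟩
  refine (Set.ncard_le_ncard hsub (Finset.finite_toSet _)).trans ?_
  rw [Set.ncard_coe_finset]
  refine Finset.card_image_le.trans ?_
  rw [Finset.card_sigma]
  refine (Finset.sum_le_sum fun p _ => card_filter_two_mul_le p.2 _).trans ?_
  rw [Finset.sum_const, smul_eq_mul, mul_comm, ← Nat.map_div_right_divisors, Finset.card_map]

variable {M : Type*} [AddCommGroup M]

theorem setOf_index_eq_of_equiv (e : M ≃+ ℤ × ℤ) (m : ℕ) :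
    {K : AddSubgroup M | K.index = m} =
      (fun K => K.comap (e : M →+ ℤ × ℤ)) '' {K : AddSubgroup (ℤ × ℤ) | K.index = m} := by
  ext K
  constructor
  · intro hK
    refine ⟨K.comap (e.symm : ℤ × ℤ →+ M), ?_, ?_⟩
    · simpa [AddSubgroup.index_comap_of_surjective _ (f := (e.symm : ℤ × ℤ →+ M))
        e.symm.surjective] using hK
    · ext x; simp
  · rintro ⟨K, hK, rfl⟩
    simpa [AddSubgroup.index_comap_of_surjective _ (f := (e : M →+ ℤ × ℤ)) e.surjective] using hK

theorem comap_equiv_injective (e : M ≃+ ℤ × ℤ) :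
    Function.Injective fun K : AddSubgroup (ℤ × ℤ) => K.comap (e : M →+ ℤ × ℤ) :=
  AddSubgroup.comap_injective e.surjective

theorem finite_setOf_index_eq_of_equiv (e : M ≃+ ℤ × ℤ) {m : ℕ} (hm : m ≠ 0) :
    {K : AddSubgroup M | K.index = m}.Finite := by
  rw [setOf_index_eq_of_equiv e]
  exact (finite_setOf_index_eq hm).image _

theorem ncard_setOf_index_eq_of_equiv (e : M ≃+ ℤ × ℤ) {m : ℕ} (hm : m ≠ 0) :
    {K : AddSubgroup M | K.index = m}.ncard = ∑ d ∈ m.divisors, d := by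
  rw [setOf_index_eq_of_equiv e, Set.ncard_image_of_injective _ (comap_equiv_injective e),
    ncard_setOf_index_eq hm]

theorem ncard_setOf_index_eq_and_stable_le_of_equiv (e : M ≃+ ℤ × ℤ) {m : ℕ} (hm : m ≠ 0)
    (g : M → M) (k : ℤ) (hg : ∀ x, e (g x) = ((e x).1, k * (e x).1 - (e x).2)) :
    {K : AddSubgroup M | K.index = m ∧ ∀ x ∈ K, g x ∈ K}.ncard ≤ 2 * m.divisors.card := by
  refine le_trans ?_ (ncard_setOf_index_eq_and_stable_le hm k)
  rw [← Set.ncard_image_of_injective _ (comap_equiv_injective e)]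
  refine Set.ncard_le_ncard ?_ (((finite_setOf_index_eq hm).subset fun K hK => hK.1).image _)
  rintro K ⟨hK, hst⟩
  refine ⟨K.comap (e.symm : ℤ × ℤ →+ M), ⟨?_, fun p hp => ?_⟩, ?_⟩
  · simpa [AddSubgroup.index_comap_of_surjective _ (f := (e.symm : ℤ × ℤ →+ M))
      e.symm.surjective] using hK
  · have := hst _ hp
    have h2 := hg (e.symm p)
    simp only [AddEquiv.apply_symm_apply] at h2
    change e.symm _ ∈ K
    rw [← h2, AddEquiv.symm_apply_apply]
    exact this
  · ext x; simp

end PlaneLattices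

/-! ### Integral involutions in rank two -/

section Involutions

variable {M : Type*} [AddCommGroup M]

/-- An involution `g ≠ ±1` of a lattice of rank two has the shape `(x, y) ↦ (x, k x - y)` in
suitable coordinates. -/
theorem exists_equiv_of_involution (b : Module.Basis (Fin 2) ℤ M) (g : M →ₗ[ℤ] M)
    (hg : ∀ x, g (g x) = x) (h1 : ∃ x, g x ≠ x) (h2 : ∃ x, g x ≠ -x) :
    ∃ (e : M ≃+ ℤ × ℤ) (k : ℤ), ∀ x, e (g x) = ((e x).1, k * (e x).1 - (e x).2) := by
  have : Module.Free ℤ M := Module.Free.of_basis b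
  have : Module.Finite ℤ M := Module.Finite.of_basis b
  -- The kernel of `g + 1` is the `-1`-eigenlattice. It contains every `g x - x`, so `g ≠ 1` makes
  -- it nonzero, and `g ≠ -1` makes the range nonzero; both then have rank one.
  set h : M →ₗ[ℤ] M := g + LinearMap.id
  have hh : ∀ x, h x = g x + x := fun x => rfl
  have hr := Submodule.finrank_quotient_add_finrank (LinearMap.ker h)
  rw [h.quotKerEquivRange.finrank_eq, Module.finrank_eq_card_basis b, Fintype.card_fin] at hr
  have hk0 : Module.finrank ℤ (LinearMap.ker h) ≠ 0 := by
    intro h0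
    rw [Submodule.finrank_eq_zero] at h0
    obtain ⟨x, hx⟩ := h1
    have : g x - x ∈ LinearMap.ker h := by
      rw [LinearMap.mem_ker, hh, map_sub, hg]; abel
    rw [h0, Submodule.mem_bot, sub_eq_zero] at this
    exact hx this
  have hr0 : Module.finrank ℤ (LinearMap.range h) ≠ 0 := by
    intro h0
    rw [Submodule.finrank_eq_zero, LinearMap.range_eq_bot] at h0
    obtain ⟨x, hx⟩ := h2
    exact hx (eq_neg_of_add_eq_zero_left (by rw [← hh, h0, LinearMap.zero_apply]))
  have er : LinearMap.range h ≃ₗ[ℤ] ℤ := LinearEquiv.ofFinrankEq _ _ (by simp; omega)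
  have ek : LinearMap.ker h ≃ₗ[ℤ] ℤ := LinearEquiv.ofFinrankEq _ _ (by simp; omega)
  set p : M →ₗ[ℤ] ℤ := er.toLinearMap ∘ₗ h.rangeRestrict
  have hp0 : ∀ x, p x = 0 ↔ h x = 0 := fun x => by
    simp only [p, LinearMap.comp_apply, LinearEquiv.coe_coe, map_eq_zero_iff er er.injective]
    rw [Subtype.ext_iff]; rfl
  -- The range is free, so the lattice splits as `ℤ x0 ⊕ ℤ w` with `w` spanning the kernel. Then `g
  -- w = -w`, and `g x0 - x0 = k w` provides the integer `k`.
  obtain ⟨x0, hx0⟩ : ∃ x0, p x0 = 1 := by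
    have : Function.Surjective p := er.surjective.comp h.surjective_rangeRestrict
    exact this 1
  set w : M := ((ek.symm 1 : LinearMap.ker h) : M)
  have hw : h w = 0 := (ek.symm 1).2
  have hwk : ∀ x, h x = 0 → ∃ y : ℤ, x = y • w := fun x hx => by
    refine ⟨ek ⟨x, hx⟩, ?_⟩
    rw [← Submodule.coe_smul, ← map_smul, smul_eq_mul, mul_one, LinearEquiv.symm_apply_apply]
  have hw0 : ∀ y : ℤ, y • w = 0 → y = 0 := fun y hy => by
    rw [← Submodule.coe_smul, ← map_smul, smul_eq_mul, mul_one, Submodule.coe_eq_zero] at hy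
    simpa using hy
  have hpg : ∀ x, p (g x) = p x := fun x => by
    have : p (g x - x) = 0 := by rw [hp0, hh, map_sub, hg]; abel
    rwa [map_sub, sub_eq_zero] at this
  obtain ⟨k, hk⟩ := hwk (g x0 - x0) (by rw [← hp0, map_sub, hpg, sub_self])
  let f : ℤ × ℤ →+ M :=
    { toFun := fun q => q.1 • x0 + q.2 • w
      map_zero' := by simp
      map_add' := fun q r => by simp only [Prod.fst_add, Prod.snd_add, add_smul]; abel }
  have hf : ∀ q, f q = q.1 • x0 + q.2 • w := fun q => rfl
  have hbij : Function.Bijective f := by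
    refine ⟨(injective_iff_map_eq_zero f).2 fun q hq => ?_, fun x => ?_⟩
    · rw [hf] at hq
      have h1 : q.1 = 0 := by
        have := congrArg p hq
        rwa [map_add, map_smul, map_smul, hx0, (hp0 w).2 hw, smul_zero, add_zero, smul_eq_mul,
          mul_one, map_zero] at this
      rw [h1, zero_smul, zero_add] at hq
      exact Prod.ext h1 (hw0 _ hq)
    · obtain ⟨y, hy⟩ := hwk (x - p x • x0) (by rw [← hp0, map_sub, map_smul, hx0]; simp)
      exact ⟨(p x, y), by rw [hf, ← hy]; abel⟩
  have hgw : g w = -w := eq_neg_of_add_eq_zero_left (by rw [← hh, hw])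
  refine ⟨(AddEquiv.ofBijective f hbij).symm, k, fun x => ?_⟩
  obtain ⟨q, rfl⟩ := hbij.2 x
  have e1 : ∀ q, (AddEquiv.ofBijective f hbij).symm (f q) = q :=
    fun q => (AddEquiv.ofBijective f hbij).symm_apply_apply q
  have e2 : g (f q) = f (q.1, k * q.1 - q.2) := by
    rw [hf, hf, map_add, map_smul, map_smul, hgw, ← sub_add_cancel (g x0) x0, hk]
    module
  rw [e2, e1, e1]

/-- The number of subgroups of index `m` stable under an involution `g ≠ ±1` of a lattice of rank
two. -/
theorem ncard_stable_involution_le (b : Module.Basis (Fin 2) ℤ M) (g : M →ₗ[ℤ] M)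
    (hg : ∀ x, g (g x) = x) (h1 : ∃ x, g x ≠ x) (h2 : ∃ x, g x ≠ -x) {m : ℕ} (hm : m ≠ 0) :
    {K : AddSubgroup M | K.index = m ∧ ∀ x ∈ K, g x ∈ K}.ncard ≤ 2 * m.divisors.card := by
  obtain ⟨e, k, h⟩ := exists_equiv_of_involution b g hg h1 h2
  exact ncard_setOf_index_eq_and_stable_le_of_equiv e hm g k h

/-- Coordinates with respect to a basis of a lattice of rank two. -/
noncomputable def coordEquiv (b : Module.Basis (Fin 2) ℤ M) : M ≃+ ℤ × ℤ :=
  (b.equivFun.trans (LinearEquiv.finTwoArrow ℤ ℤ)).toAddEquiv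

end Involutions

/-- Counting a set that is partitioned by a doubly indexed finite family. -/
theorem ncard_eq_sum_sum {α β γ : Type*} (s : Finset α) (t : α → Finset β) (P : α → β → Set γ)
    (S : Set γ) (hfin : ∀ a ∈ s, ∀ b ∈ t a, (P a b).Finite)
    (hsub : ∀ a ∈ s, ∀ b ∈ t a, P a b ⊆ S)
    (hdisj : ∀ a ∈ s, ∀ b ∈ t a, ∀ a' ∈ s, ∀ b' ∈ t a', ∀ k ∈ P a b, k ∈ P a' b' →
      a = a' ∧ b = b')
    (hcov : ∀ k ∈ S, ∃ a ∈ s, ∃ b ∈ t a, k ∈ P a b) :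
    S.ncard = ∑ a ∈ s, ∑ b ∈ t a, (P a b).ncard := by
  have hS : S = ⋃ x ∈ (s.sigma t : Set ((_ : α) × β)), P x.1 x.2 := by
    ext k
    simp only [Set.mem_iUnion, Finset.mem_coe, Finset.mem_sigma]
    constructor
    · intro hk
      obtain ⟨a, ha, b, hb, h⟩ := hcov k hk
      exact ⟨⟨a, b⟩, ⟨ha, hb⟩, h⟩
    · rintro ⟨⟨a, b⟩, ⟨ha, hb⟩, h⟩
      exact hsub a ha b hb h
  rw [hS, (Finset.finite_toSet _).ncard_biUnion, finsum_mem_coe_finset, Finset.sum_sigma]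
  · rintro ⟨a, b⟩ h
    obtain ⟨ha, hb⟩ := Finset.mem_sigma.1 h
    exact hfin a ha b hb
  · rintro ⟨a, b⟩ h ⟨a', b'⟩ h' hne
    obtain ⟨ha, hb⟩ := Finset.mem_sigma.1 h
    obtain ⟨ha', hb'⟩ := Finset.mem_sigma.1 h'
    refine Set.disjoint_left.2 fun k hk hk' => hne ?_
    obtain ⟨rfl, rfl⟩ := hdisj a ha b hb a' ha' b' hb' k hk hk'
    rfl

/-! ### Sorting subgroups by the ideal that they generate -/

section Hull

set_option linter.unusedSectionVars false

variable {F : Type*} [Field F] [NumberField F]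

theorem index_eq_absNorm (J : Ideal (𝓞 F)) : J.toAddSubgroup.index = Ideal.absNorm J := by
  rw [Ideal.absNorm_apply, Submodule.cardQuot]

theorem relIndex_mul_ideal (a : Ideal (𝓞 F)) {J : Ideal (𝓞 F)} (hJ : J ≠ ⊥) :
    (a * J).toAddSubgroup.relIndex J.toAddSubgroup = Ideal.absNorm a := by
  have h := AddSubgroup.relIndex_mul_index (H := (a * J).toAddSubgroup) (K := J.toAddSubgroup)
    (Ideal.mul_le_right (I := a) (J := J))
  rw [index_eq_absNorm, index_eq_absNorm, map_mul] at h
  exact Nat.eq_of_mul_eq_mul_right (Nat.pos_of_ne_zero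
    (by rw [Ne, Ideal.absNorm_eq_zero_iff]; exact hJ)) h

/-- The additive subgroups of index `f` of the ideal `J` that generate `J` as an ideal. -/
def primitiveSubgroups (J : Ideal (𝓞 F)) (f : ℕ) : Set (AddSubgroup (𝓞 F)) :=
  {K | Ideal.span (K : Set (𝓞 F)) = J ∧ K.relIndex J.toAddSubgroup = f}

/-- The additive subgroups of index `m` of the ideal `J`. -/
def subgroupsOfIndex (J : Ideal (𝓞 F)) (m : ℕ) : Set (AddSubgroup (𝓞 F)) :=
  {K | K ≤ J.toAddSubgroup ∧ K.relIndex J.toAddSubgroup = m}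

theorem le_of_mem_primitiveSubgroups {J : Ideal (𝓞 F)} {f : ℕ} {K : AddSubgroup (𝓞 F)}
    (h : K ∈ primitiveSubgroups J f) : K ≤ J.toAddSubgroup := fun x hx => by
  rw [Submodule.mem_toAddSubgroup, ← h.1]
  exact Ideal.subset_span hx

theorem primitiveSubgroups_subset (J : Ideal (𝓞 F)) (f : ℕ) :
    primitiveSubgroups J f ⊆ subgroupsOfIndex J f :=
  fun _ h => ⟨le_of_mem_primitiveSubgroups h, h.2⟩

theorem subgroupsOfIndex_eq (J : Ideal (𝓞 F)) (m : ℕ) :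
    subgroupsOfIndex J m = (fun K : AddSubgroup J.toAddSubgroup => K.map J.toAddSubgroup.subtype) ''
      {K | K.index = m} := by
  ext K
  constructor
  · rintro ⟨h1, h2⟩
    exact ⟨K.addSubgroupOf J.toAddSubgroup, h2, AddSubgroup.map_addSubgroupOf_eq_of_le h1⟩
  · rintro ⟨K, hK, rfl⟩
    refine ⟨AddSubgroup.map_subtype_le K, ?_⟩
    rw [AddSubgroup.relIndex]
    change (AddSubgroup.comap _ (AddSubgroup.map _ K)).index = m
    rw [AddSubgroup.comap_map_eq_self_of_injective J.toAddSubgroup.subtype_injective]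
    exact hK

/-- An integral basis of the ring of integers of a quadratic field. -/
noncomputable def quadraticBasis (hF : Module.finrank ℚ F = 2) :
    Module.Basis (Fin 2) ℤ (𝓞 F) :=
  (RingOfIntegers.basis F).reindex (Fintype.equivFinOfCardEq (by
    rw [← Module.finrank_eq_card_basis (RingOfIntegers.basis F), RingOfIntegers.rank, hF]))

/-- A `ℤ`-basis of a nonzero ideal in a quadratic field. -/
noncomputable def idealBasis (hF : Module.finrank ℚ F = 2) {J : Ideal (𝓞 F)} (hJ : J ≠ ⊥) :
    Module.Basis (Fin 2) ℤ J :=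
  Ideal.selfBasis (quadraticBasis hF) J hJ

theorem finite_subgroupsOfIndex (hF : Module.finrank ℚ F = 2) {J : Ideal (𝓞 F)} (hJ : J ≠ ⊥)
    {m : ℕ} (hm : m ≠ 0) : (subgroupsOfIndex J m).Finite := by
  rw [subgroupsOfIndex_eq]
  exact (finite_setOf_index_eq_of_equiv (coordEquiv (idealBasis hF hJ)) hm).image _

theorem ncard_subgroupsOfIndex (hF : Module.finrank ℚ F = 2) {J : Ideal (𝓞 F)} (hJ : J ≠ ⊥)
    {m : ℕ} (hm : m ≠ 0) : (subgroupsOfIndex J m).ncard = ∑ d ∈ m.divisors, d := by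
  rw [subgroupsOfIndex_eq, Set.ncard_image_of_injective _
    (AddSubgroup.map_injective J.toAddSubgroup.subtype_injective)]
  exact ncard_setOf_index_eq_of_equiv (coordEquiv (idealBasis hF hJ)) hm

theorem finite_primitiveSubgroups (hF : Module.finrank ℚ F = 2) {J : Ideal (𝓞 F)} (hJ : J ≠ ⊥)
    {f : ℕ} (hf : f ≠ 0) : (primitiveSubgroups J f).Finite :=
  (finite_subgroupsOfIndex hF hJ hf).subset (primitiveSubgroups_subset J f)

theorem mul_ne_bot_of_absNorm {a I : Ideal (𝓞 F)} (hI : I ≠ ⊥) {n : ℕ} (hn : n ≠ 0)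
    (ha : Ideal.absNorm a = n) : a * I ≠ ⊥ := by
  intro h0
  rcases Ideal.mul_eq_bot.1 h0 with rfl | h
  · exact hn (by rw [← ha]; simp)
  · exact hI h

/-- In a Dedekind domain containment of ideals is divisibility, which yields the cofactor `a`; the
index relation is the tower law together with `[J : a * J] = N(a)`. -/
theorem exists_span_eq_mul {J : Ideal (𝓞 F)} (hJ : J ≠ ⊥) {m : ℕ} (hm : m ≠ 0)
    {K : AddSubgroup (𝓞 F)} (hK : K ∈ subgroupsOfIndex J m) :
    ∃ a : Ideal (𝓞 F), Ideal.span (K : Set (𝓞 F)) = a * J ∧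
      (Ideal.absNorm a, K.relIndex (a * J).toAddSubgroup) ∈ m.divisorsAntidiagonal := by
  have hle : Ideal.span (K : Set (𝓞 F)) ≤ J := Ideal.span_le.2 hK.1
  obtain ⟨a, ha⟩ := Ideal.dvd_iff_le.2 hle
  rw [mul_comm] at ha
  refine ⟨a, ha, ?_⟩
  have hKle : K ≤ (a * J).toAddSubgroup := fun x hx => by
    rw [Submodule.mem_toAddSubgroup, ← ha]
    exact Ideal.subset_span hx
  have hmul := AddSubgroup.relIndex_mul_relIndex K (a * J).toAddSubgroup J.toAddSubgroup
    hKle (Ideal.mul_le_right (I := a) (J := J))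
  rw [hK.2, relIndex_mul_ideal a hJ] at hmul
  rw [Nat.mem_divisorsAntidiagonal, mul_comm]
  exact ⟨hmul, hm⟩

/-- Sorting the subgroups of `J` by the ideal that they generate. -/
theorem sum_ncard_primitiveSubgroups (hF : Module.finrank ℚ F = 2) {J : Ideal (𝓞 F)} (hJ : J ≠ ⊥)
    {m : ℕ} (hm : m ≠ 0) :
    ∑ p ∈ m.divisorsAntidiagonal, ∑ a ∈ idealsOfNorm F p.1, (primitiveSubgroups (a * J) p.2).ncard =
      ∑ d ∈ m.divisors, d := by
  have hcond : ∀ p ∈ m.divisorsAntidiagonal, ∀ a ∈ idealsOfNorm F p.1,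
      a * J ≠ ⊥ ∧ p.2 ≠ 0 := by
    intro p hp a ha
    rw [Nat.mem_divisorsAntidiagonal] at hp
    rw [mem_idealsOfNorm] at ha
    have : p.1 * p.2 ≠ 0 := by rw [hp.1]; exact hm
    exact ⟨mul_ne_bot_of_absNorm hJ (left_ne_zero_of_mul this) ha, right_ne_zero_of_mul this⟩
  rw [← ncard_subgroupsOfIndex hF hJ hm]
  refine (ncard_eq_sum_sum m.divisorsAntidiagonal (fun p => idealsOfNorm F p.1)
    (fun p (a : Ideal (𝓞 F)) => primitiveSubgroups (a * J) p.2) (subgroupsOfIndex J m)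
    ?_ ?_ ?_ ?_).symm
  · exact fun p hp a ha => finite_primitiveSubgroups hF (hcond p hp a ha).1 (hcond p hp a ha).2
  · intro p hp a ha K hK
    have hle := Ideal.mul_le_right (I := a) (J := J)
    refine ⟨(le_of_mem_primitiveSubgroups hK).trans hle, ?_⟩
    rw [← AddSubgroup.relIndex_mul_relIndex K (a * J).toAddSubgroup J.toAddSubgroup
      (le_of_mem_primitiveSubgroups hK) hle, hK.2, relIndex_mul_ideal a hJ,
      mem_idealsOfNorm.1 ha, mul_comm, (Nat.mem_divisorsAntidiagonal.1 hp).1]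
  · intro p hp a ha q hq b hb K hK hK'
    have hab : a * J = b * J := hK.1.symm.trans hK'.1
    obtain rfl : a = b := mul_right_cancel₀ (by rwa [Ideal.zero_eq_bot]) hab
    refine ⟨Prod.ext ?_ (hK.2.symm.trans hK'.2), rfl⟩
    rw [← mem_idealsOfNorm.1 ha, ← mem_idealsOfNorm.1 hb]
  · intro K hK
    obtain ⟨a, ha, hp⟩ := exists_span_eq_mul hJ hm hK
    exact ⟨_, hp, a, mem_idealsOfNorm.2 rfl, ha, rfl⟩

variable (F) in
/-- The number of subgroups of index `f` of the ring of integers that generate the unit ideal. -/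
noncomputable def primitiveCount (f : ℕ) : ℕ := (primitiveSubgroups (⊤ : Ideal (𝓞 F)) f).ncard

/-- All nonzero `J` have the same number `σ₁(f)` of subgroups of index `f`. In the sum over
generated ideals `a * J`, every term with `N(a) ≠ 1` concerns an index smaller than `f`, so by
induction only the term `a = ⊤` is left to compare. -/
theorem ncard_primitiveSubgroups (hF : Module.finrank ℚ F = 2) {f : ℕ} (hf : f ≠ 0) :
    ∀ {J : Ideal (𝓞 F)}, J ≠ ⊥ → (primitiveSubgroups J f).ncard = primitiveCount F f := by
  induction f using Nat.strong_induction_on with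
  | _ f ih =>
    intro J hJ
    have hT : (⊤ : Ideal (𝓞 F)) ≠ ⊥ := top_ne_bot
    have h := (sum_ncard_primitiveSubgroups hF hJ hf).trans
      (sum_ncard_primitiveSubgroups hF hT hf).symm
    have hmem : (1, f) ∈ f.divisorsAntidiagonal := by simp [hf]
    rw [← Finset.add_sum_erase _ _ hmem, ← Finset.add_sum_erase _ _ hmem] at h
    have hrest : ∀ p ∈ f.divisorsAntidiagonal.erase (1, f), ∀ a ∈ idealsOfNorm F p.1,
        (primitiveSubgroups (a * J) p.2).ncard = (primitiveSubgroups (a * ⊤) p.2).ncard := by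
      intro p hp a ha
      rw [Finset.mem_erase, Nat.mem_divisorsAntidiagonal] at hp
      obtain ⟨hp1, hp2, -⟩ := hp
      have hne : p.1 * p.2 ≠ 0 := by rw [hp2]; exact hf
      have hpl : p.2 < f := by
        refine lt_of_le_of_ne (Nat.le_of_dvd (Nat.pos_of_ne_zero hf) ⟨p.1, by rw [← hp2, mul_comm]⟩)
          fun h => hp1 (Prod.ext ?_ h)
        rw [h] at hp2
        exact Nat.eq_of_mul_eq_mul_right (Nat.pos_of_ne_zero hf) (by rw [hp2, one_mul])
      have ha0 : a ≠ ⊥ := by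
        rintro rfl
        exact left_ne_zero_of_mul hne (by simpa using (mem_idealsOfNorm.1 ha).symm)
      rw [ih p.2 hpl (right_ne_zero_of_mul hne) (by simp [ha0, hJ]),
        ih p.2 hpl (right_ne_zero_of_mul hne) (by simp [ha0])]
    rw [Finset.sum_congr rfl fun p hp => Finset.sum_congr rfl (hrest p hp)] at h
    have := Nat.add_right_cancel h
    simpa [idealsOfNorm_one, primitiveCount, Ideal.top_mul] using this

/-- The convolution identity `ζ_F(s) * ∑ ψ(f) f⁻ˢ = ζ(s) ζ(s - 1)` on coefficients. -/
theorem sum_idealCount_mul_primitiveCount (hF : Module.finrank ℚ F = 2) {m : ℕ} (hm : m ≠ 0) :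
    ∑ p ∈ m.divisorsAntidiagonal, idealCount F p.1 * primitiveCount F p.2 =
      ∑ d ∈ m.divisors, d := by
  rw [← sum_ncard_primitiveSubgroups hF (top_ne_bot (α := Ideal (𝓞 F))) hm]
  refine Finset.sum_congr rfl fun p hp => ?_
  rw [Nat.mem_divisorsAntidiagonal] at hp
  have hne : p.1 * p.2 ≠ 0 := by rw [hp.1]; exact hm
  rw [Finset.sum_congr rfl fun a ha => ncard_primitiveSubgroups hF (right_ne_zero_of_mul hne)
    (J := a * ⊤) ?_, Finset.sum_const, smul_eq_mul, idealCount]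
  rw [Ideal.mul_top]
  rintro rfl
  exact left_ne_zero_of_mul hne (by simpa using (mem_idealsOfNorm.1 ha).symm)

theorem primitiveCount_le (hF : Module.finrank ℚ F = 2) {m : ℕ} (hm : m ≠ 0) :
    primitiveCount F m ≤ ∑ d ∈ m.divisors, d := by
  rw [← ncard_subgroupsOfIndex hF (top_ne_bot (α := Ideal (𝓞 F))) hm]
  exact Set.ncard_le_ncard (primitiveSubgroups_subset _ _)
    (finite_subgroupsOfIndex hF top_ne_bot hm)

end Hull

/-! ### Norm-preserving maps of a quadratic field -/

section QuadraticExtension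

variable {F : Type*} [Field F] [Algebra ℚ F]

/-- Cayley–Hamilton for multiplication by `x`. -/
theorem sq_eq_trace_mul_sub_norm (hF : Module.finrank ℚ F = 2) (x : F) :
    x ^ 2 = algebraMap ℚ F (Algebra.trace ℚ F x) * x - algebraMap ℚ F (Algebra.norm ℚ x) := by
  have : FiniteDimensional ℚ F := Module.finite_of_finrank_pos (by omega)
  let b := Module.finBasisOfFinrankEq ℚ F hF
  have h := Matrix.aeval_self_charpoly (Algebra.leftMulMatrix b x)
  rw [Matrix.charpoly_fin_two, ← Algebra.trace_eq_matrix_trace b,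
    ← Algebra.norm_eq_matrix_det b, Polynomial.aeval_algHom_apply] at h
  have h2 := (map_eq_zero_iff _ (Algebra.leftMulMatrix_injective b)).1 h
  simp only [map_add, map_sub, map_pow, map_mul, Polynomial.aeval_X, Polynomial.aeval_C] at h2
  linear_combination h2

theorem norm_add_algebraMap (hF : Module.finrank ℚ F = 2) (x : F) (q : ℚ) :
    Algebra.norm ℚ (x + algebraMap ℚ F q) =
      Algebra.norm ℚ x + q * Algebra.trace ℚ F x + q ^ 2 := by
  have : FiniteDimensional ℚ F := Module.finite_of_finrank_pos (by omega)
  let b := Module.finBasisOfFinrankEq ℚ F hF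
  rw [Algebra.norm_eq_matrix_det b, Algebra.norm_eq_matrix_det b,
    Algebra.trace_eq_matrix_trace b, map_add, AlgHom.commutes, Matrix.det_fin_two,
    Matrix.det_fin_two, Matrix.trace_fin_two]
  simp [Matrix.algebraMap_matrix_apply]
  ring

theorem trace_algebraMap_of_finrank_two (hF : Module.finrank ℚ F = 2) (q : ℚ) :
    Algebra.trace ℚ F (algebraMap ℚ F q) = 2 * q := by
  rw [Algebra.trace_algebraMap, hF]; simp

theorem norm_algebraMap_of_finrank_two (hF : Module.finrank ℚ F = 2) (q : ℚ) :
    Algebra.norm ℚ (algebraMap ℚ F q) = q ^ 2 := by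
  rw [Algebra.norm_algebraMap, hF]

/-- A norm-preserving linear automorphism of a quadratic field is a field automorphism followed
by a multiplication. -/
theorem exists_eq_mul_algEquiv (hF : Module.finrank ℚ F = 2) (g : F ≃ₗ[ℚ] F)
    (hg : ∀ x, Algebra.norm ℚ (g x) = Algebra.norm ℚ x) :
    ∃ c : F ≃ₐ[ℚ] F, ∀ x, g x = g 1 * c x := by
  have hu : Algebra.norm ℚ (g 1) = 1 := by rw [hg, map_one]
  have hu0 : g 1 ≠ 0 := by simp
  -- Normalized to fix `1`, the map preserves norms; comparing the norms of `x + 1` and `τ x + 1`,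
  -- it preserves traces; hence by `x² = Tr(x) x - N(x)` it preserves squares, and by polarization
  -- products.
  let τ : F →ₗ[ℚ] F := LinearMap.mulLeft ℚ (g 1)⁻¹ ∘ₗ g.toLinearMap
  have hτ : ∀ x, τ x = (g 1)⁻¹ * g x := fun x => rfl
  have h1 : τ 1 = 1 := by rw [hτ, inv_mul_cancel₀ hu0]
  have hq : ∀ q : ℚ, τ (algebraMap ℚ F q) = algebraMap ℚ F q := fun q => by
    rw [Algebra.algebraMap_eq_smul_one, map_smul, h1]
  have hN : ∀ x, Algebra.norm ℚ (τ x) = Algebra.norm ℚ x := fun x => by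
    rw [hτ, map_mul, hg]
    have : Algebra.norm ℚ (g 1)⁻¹ = 1 := by
      have := map_mul (Algebra.norm ℚ) (g 1) (g 1)⁻¹
      rw [mul_inv_cancel₀ hu0, hu, one_mul, map_one] at this
      exact this.symm
    rw [this, one_mul]
  have hT : ∀ x, Algebra.trace ℚ F (τ x) = Algebra.trace ℚ F x := fun x => by
    have h := hN (x + algebraMap ℚ F 1)
    rw [map_add, hq, norm_add_algebraMap hF, norm_add_algebraMap hF, hN] at h
    linarith
  have hsq : ∀ x, τ (x ^ 2) = τ x ^ 2 := fun x => by
    rw [sq_eq_trace_mul_sub_norm hF x, sq_eq_trace_mul_sub_norm hF (τ x), hT, hN, map_sub, hq,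
      ← Algebra.smul_def, ← Algebra.smul_def, map_smul]
  have hmul : ∀ x y, τ (x * y) = τ x * τ y := fun x y => by
    have h := hsq (x + y)
    have e : (x + y) ^ 2 = x ^ 2 + (2 : ℚ) • (x * y) + y ^ 2 := by
      rw [Algebra.smul_def]; simp; ring
    rw [e, map_add, map_add, map_smul, hsq, hsq, map_add, Algebra.smul_def] at h
    simp only [map_ofNat] at h
    have : (2 : F) * (τ (x * y) - τ x * τ y) = 0 := by linear_combination h
    have hchar : CharZero F := algebraRat.charZero F
    rcases mul_eq_zero.1 this with h | h
    · exact absurd h two_ne_zero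
    · exact sub_eq_zero.1 h
  have hbij : Function.Bijective (AlgHom.ofLinearMap τ h1 hmul) := by
    have : ⇑(AlgHom.ofLinearMap τ h1 hmul) = (fun x => (g 1)⁻¹ * x) ∘ g := rfl
    rw [this]
    exact (mulLeft_bijective₀ _ (inv_ne_zero hu0)).comp g.bijective
  refine ⟨AlgEquiv.ofBijective _ hbij, fun x => ?_⟩
  have : AlgEquiv.ofBijective _ hbij x = (g 1)⁻¹ * g x := rfl
  rw [this, mul_inv_cancel_left₀ hu0]

/-- An element moved by `c` goes to the other root of its quadratic equation. For a fixed `y`,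
compare the formulas at `x` and `x + y`, where `x` is moved. -/
theorem algEquiv_apply_eq_trace_sub (hF : Module.finrank ℚ F = 2) {c : F ≃ₐ[ℚ] F} (hc : c ≠ 1)
    (y : F) : c y = algebraMap ℚ F (Algebra.trace ℚ F y) - y := by
  have key : ∀ x, c x ≠ x → c x = algebraMap ℚ F (Algebra.trace ℚ F x) - x := by
    intro x hx
    have h1 := sq_eq_trace_mul_sub_norm hF x
    have h2 := congrArg c h1
    rw [map_pow, map_sub, map_mul, AlgEquiv.commutes, AlgEquiv.commutes] at h2
    have : (c x - x) * (c x - (algebraMap ℚ F (Algebra.trace ℚ F x) - x)) = 0 := by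
      linear_combination h2 - h1
    rcases mul_eq_zero.1 this with h | h
    · exact absurd (sub_eq_zero.1 h) hx
    · exact sub_eq_zero.1 h
  by_cases hy : c y = y
  · obtain ⟨x, hx⟩ : ∃ x, c x ≠ x := by
      by_contra hcon
      push Not at hcon
      exact hc (AlgEquiv.ext hcon)
    have h1 := key x hx
    have h2 := key (x + y) (by rw [map_add, hy]; simpa using hx)
    rw [map_add, map_add, map_add, h1, hy] at h2
    rw [hy]
    linear_combination h2
  · exact key y hy

/-- A norm-preserving linear automorphism that is not a multiplication is an involution. -/
theorem apply_apply_of_ne_one (hF : Module.finrank ℚ F = 2) {g : F ≃ₗ[ℚ] F}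
    (hg : ∀ x, Algebra.norm ℚ (g x) = Algebra.norm ℚ x) {c : F ≃ₐ[ℚ] F}
    (hgc : ∀ x, g x = g 1 * c x) (hc : c ≠ 1) (x : F) : g (g x) = x := by
  have hu : Algebra.norm ℚ (g 1) = 1 := by rw [hg, map_one]
  have h1 := sq_eq_trace_mul_sub_norm hF (g 1)
  rw [hu, (algebraMap ℚ F).map_one] at h1
  have h2 : c (c x) = x := by
    rw [algEquiv_apply_eq_trace_sub hF hc x, map_sub, AlgEquiv.commutes,
      algEquiv_apply_eq_trace_sub hF hc x]
    ring
  -- `g (g x) = g 1 * c (g 1) * x`, and `g 1 * c (g 1)` is the norm of `g 1`, which is `1`.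
  rw [hgc (g x), hgc x, map_mul, h2, algEquiv_apply_eq_trace_sub hF hc (g 1)]
  linear_combination (-x) * h1

/-- In an imaginary quadratic field there are finitely many integers of given norm. -/
theorem finite_setOf_isIntegral_norm_eq (hF : Module.finrank ℚ F = 2)
    (hN : ∀ x : F, 0 ≤ Algebra.norm ℚ x) (r : ℚ) :
    {x : F | IsIntegral ℤ x ∧ Algebra.norm ℚ x = r}.Finite := by
  have : FiniteDimensional ℚ F := Module.finite_of_finrank_pos (by omega)
  -- The norm of `x - Tr(x) / 2` is `N(x) - Tr(x)² / 4`. It is nonnegative, so the integer `Tr(x)`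
  -- satisfies `Tr(x)² ≤ 4 r`; each trace leaves one quadratic equation for `x`.
  obtain ⟨B, hB⟩ := exists_nat_gt (4 * r)
  have hpoly : ∀ t : ℤ, {x : F | x ^ 2 = (t : F) * x - algebraMap ℚ F r}.Finite := by
    intro t
    let p : Polynomial F := Polynomial.X ^ 2 - Polynomial.C (t : F) * Polynomial.X +
      Polynomial.C (algebraMap ℚ F r)
    have hp : p.Monic := by
      simp only [p]; monicity!
    refine (p.rootSet_finite F).subset fun x hx => ?_
    rw [Polynomial.mem_rootSet]
    refine ⟨hp.ne_zero, ?_⟩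
    simp only [Set.mem_ofPred_eq] at hx
    simp [p, hx]
  refine ((Set.finite_Icc (-(B : ℤ)) B).biUnion fun t _ => hpoly t).subset ?_
  rintro x ⟨hx, rfl⟩
  obtain ⟨t, ht⟩ := IsIntegrallyClosed.isIntegral_iff.1
    (Algebra.isIntegral_trace (L := ℚ) (F := F) hx)
  simp only [algebraMap_int_eq, eq_intCast] at ht
  refine Set.mem_biUnion (x := t) ?_ ?_
  · have h := hN (x + algebraMap ℚ F (-(Algebra.trace ℚ F x) / 2))
    rw [norm_add_algebraMap hF, ← ht] at h
    have h2 : (t : ℚ) ^ 2 ≤ B := by nlinarith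
    have h3 : t ^ 2 ≤ (B : ℤ) := by exact_mod_cast h2
    constructor <;> nlinarith
  · have := sq_eq_trace_mul_sub_norm hF x
    rw [← ht] at this
    simpa using this

end QuadraticExtension

/-! ### Lattices in the field and their images -/

section LatticesInField

set_option linter.unusedSectionVars false

variable {F : Type*} [Field F] [NumberField F]

/-- The `ℤ`-submodule of `F` underlying a subgroup of the ring of integers. -/
noncomputable def latticeOf (K : AddSubgroup (𝓞 F)) : Submodule ℤ F :=
  AddSubgroup.toIntSubmodule (K.map (algebraMap (𝓞 F) F).toAddMonoidHom)

theorem mem_latticeOf {K : AddSubgroup (𝓞 F)} {x : F} :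
    x ∈ latticeOf K ↔ ∃ k ∈ K, (k : F) = x := Iff.rfl

theorem coe_mem_latticeOf {K : AddSubgroup (𝓞 F)} {k : 𝓞 F} : (k : F) ∈ latticeOf K ↔ k ∈ K := by
  rw [mem_latticeOf]
  constructor
  · rintro ⟨k', h, e⟩
    rwa [← RingOfIntegers.coe_injective e]
  · exact fun h => ⟨k, h, rfl⟩

theorem latticeOf_injective : Function.Injective (latticeOf (F := F)) := fun K K' h => by
  ext x
  rw [← coe_mem_latticeOf, h, coe_mem_latticeOf]

theorem latticeOf_le_iff {K K' : AddSubgroup (𝓞 F)} : latticeOf K ≤ latticeOf K' ↔ K ≤ K' := by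
  constructor
  · exact fun h x hx => coe_mem_latticeOf.1 (h (coe_mem_latticeOf.2 hx))
  · rintro h _ ⟨x, hx, rfl⟩
    exact ⟨x, h hx, rfl⟩

theorem relIndex_latticeOf (K K' : AddSubgroup (𝓞 F)) :
    (latticeOf K).toAddSubgroup.relIndex (latticeOf K').toAddSubgroup = K.relIndex K' :=
  AddSubgroup.relIndex_map_map_of_injective K K' (f := (algebraMap (𝓞 F) F).toAddMonoidHom)
    RingOfIntegers.coe_injective

theorem exists_eq_latticeOf {K : AddSubgroup (𝓞 F)} {M : Submodule ℤ F} (h : M ≤ latticeOf K) :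
    ∃ K' ≤ K, M = latticeOf K' := by
  refine ⟨M.toAddSubgroup.comap (algebraMap (𝓞 F) F).toAddMonoidHom, ?_, ?_⟩
  · intro x hx
    exact coe_mem_latticeOf.1 (h hx)
  · ext x
    rw [mem_latticeOf]
    constructor
    · intro hx
      obtain ⟨k, -, rfl⟩ := h hx
      exact ⟨k, hx, rfl⟩
    · rintro ⟨k, hk, rfl⟩
      exact hk

theorem mem_image {V : Type*} [AddCommGroup V] [Module ℚ V] {σ : V ≃ₗ[ℚ] V} {K : Submodule ℤ V}
    {x : V} : x ∈ image σ K ↔ ∃ k ∈ K, σ k = x := Iff.rfl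

theorem image_one {V : Type*} [AddCommGroup V] [Module ℚ V] (K : Submodule ℤ V) :
    image 1 K = K := by
  ext x; simp [mem_image]

theorem image_mul {V : Type*} [AddCommGroup V] [Module ℚ V] (σ τ : V ≃ₗ[ℚ] V)
    (K : Submodule ℤ V) : image (σ * τ) K = image σ (image τ K) := by
  ext x
  simp only [mem_image]
  constructor
  · rintro ⟨k, hk, rfl⟩
    exact ⟨τ k, ⟨k, hk, rfl⟩, rfl⟩
  · rintro ⟨_, ⟨k, hk, rfl⟩, rfl⟩
    exact ⟨k, hk, rfl⟩

theorem image_le_image {V : Type*} [AddCommGroup V] [Module ℚ V] (σ : V ≃ₗ[ℚ] V)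
    {K K' : Submodule ℤ V} (h : K ≤ K') : image σ K ≤ image σ K' :=
  Submodule.map_mono h

theorem relIndex_image {V : Type*} [AddCommGroup V] [Module ℚ V] (σ : V ≃ₗ[ℚ] V)
    (K K' : Submodule ℤ V) :
    (image σ K).toAddSubgroup.relIndex (image σ K').toAddSubgroup =
      K.toAddSubgroup.relIndex K'.toAddSubgroup :=
  AddSubgroup.relIndex_map_map_of_injective K.toAddSubgroup K'.toAddSubgroup
    (f := (σ : V →ₗ[ℚ] V).toAddMonoidHom) σ.injective

theorem mem_cls_self {V : Type*} [AddCommGroup V] [Module ℚ V] (G : Subgroup (V ≃ₗ[ℚ] V))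
    (K : Submodule ℤ V) : K ∈ cls G K := ⟨1, G.one_mem, image_one K⟩

theorem cls_image {V : Type*} [AddCommGroup V] [Module ℚ V] {G : Subgroup (V ≃ₗ[ℚ] V)}
    {σ : V ≃ₗ[ℚ] V} (hσ : σ ∈ G) (K : Submodule ℤ V) : cls G (image σ K) = cls G K := by
  ext M
  constructor
  · rintro ⟨τ, hτ, rfl⟩
    exact ⟨τ * σ, G.mul_mem hτ hσ, image_mul _ _ _⟩
  · rintro ⟨τ, hτ, rfl⟩
    exact ⟨τ * σ⁻¹, G.mul_mem hτ (G.inv_mem hσ), by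
      rw [← image_mul, inv_mul_cancel_right]⟩

theorem cls_eq_iff {V : Type*} [AddCommGroup V] [Module ℚ V] {G : Subgroup (V ≃ₗ[ℚ] V)}
    {K K' : Submodule ℤ V} : cls G K = cls G K' ↔ ∃ σ ∈ G, image σ K = K' := by
  constructor
  · intro h
    have : K' ∈ cls G K := h ▸ mem_cls_self G K'
    exact this
  · rintro ⟨σ, hσ, rfl⟩
    exact (cls_image hσ K).symm

/-- Norm-preserving maps are compatible with passing to generated ideals. -/
theorem apply_mem_latticeOf_span (hF : Module.finrank ℚ F = 2) {g : F ≃ₗ[ℚ] F}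
    (hg : ∀ x, Algebra.norm ℚ (g x) = Algebra.norm ℚ x) {K K' : AddSubgroup (𝓞 F)}
    (h : ∀ x ∈ K, g x ∈ latticeOf K') {x : 𝓞 F} (hx : x ∈ Ideal.span (K : Set (𝓞 F))) :
    g x ∈ latticeOf (Ideal.span (K' : Set (𝓞 F))).toAddSubgroup := by
  obtain ⟨c, hc⟩ := exists_eq_mul_algEquiv hF g hg
  induction hx using Submodule.span_induction with
  | mem x hx =>
    obtain ⟨k, hk, e⟩ := h x hx
    exact ⟨k, Ideal.subset_span hk, e⟩
  | zero => simp
  | add x y _ _ hx hy =>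
    change g ((x : F) + (y : F)) ∈ _
    rw [map_add]
    exact add_mem hx hy
  | smul o x _ hx =>
    obtain ⟨k, hk, e⟩ := hx
    -- `g` is semilinear: `g (o x) = c(o) g(x)`, and `c(o)` is again an integer of `F`.
    have hint : IsIntegral ℤ (c (o : F)) := o.isIntegral_coe.map c
    refine ⟨⟨c o, hint⟩ * k, Ideal.mul_mem_left _ _ hk, ?_⟩
    have e' : (k : F) = g x := e
    have h1 := hc (o * x)
    have h2 := hc x
    change c o * (k : F) = g (o * x)
    rw [e', h1, h2, map_mul]
    ring

theorem image_latticeOf_span (hF : Module.finrank ℚ F = 2) {g : F ≃ₗ[ℚ] F}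
    (hg : ∀ x, Algebra.norm ℚ (g x) = Algebra.norm ℚ x) {K K' : AddSubgroup (𝓞 F)}
    (h : image g (latticeOf K) = latticeOf K') :
    image g (latticeOf (Ideal.span (K : Set (𝓞 F))).toAddSubgroup) =
      latticeOf (Ideal.span (K' : Set (𝓞 F))).toAddSubgroup := by
  refine le_antisymm ?_ ?_
  · rintro _ ⟨_, ⟨x, hx, rfl⟩, rfl⟩
    refine apply_mem_latticeOf_span hF hg (fun x hx => ?_) hx
    rw [← h]
    exact ⟨x, ⟨x, hx, rfl⟩, rfl⟩
  · have hg' : ∀ x, Algebra.norm ℚ (g.symm x) = Algebra.norm ℚ x := fun x => by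
      rw [← hg (g.symm x), LinearEquiv.apply_symm_apply]
    rintro _ ⟨x, hx, rfl⟩
    refine ⟨g.symm x, apply_mem_latticeOf_span hF hg' (fun x hx => ?_) hx,
      g.apply_symm_apply _⟩
    have : (x : F) ∈ image g (latticeOf K) := by rw [h]; exact ⟨x, hx, rfl⟩
    obtain ⟨k, hk, e⟩ := this
    have : g.symm x = k := by rw [LinearEquiv.symm_apply_eq]; exact e.symm
    rw [this]
    exact hk

end LatticesInField

/-! ### Sublattices fixed by a norm-preserving map -/

section FixedLattices

set_option linter.unusedSectionVars false

variable {F : Type*} [Field F] [NumberField F]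

/-- Every element of `F` has a nonzero multiple in a given nonzero ideal. -/
theorem exists_smul_mem_latticeOf {J : Ideal (𝓞 F)} (hJ : J ≠ ⊥) (y : F) :
    ∃ n : ℤ, n ≠ 0 ∧ n • y ∈ latticeOf J.toAddSubgroup := by
  have halg : IsAlgebraic ℤ y :=
    (IsFractionRing.isAlgebraic_iff ℤ ℚ F).2 (Algebra.IsAlgebraic.isAlgebraic y)
  obtain ⟨n, hn, hy⟩ := halg.exists_integral_multiple
  have hN : Ideal.absNorm J ≠ 0 := by rwa [Ne, Ideal.absNorm_eq_zero_iff]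
  refine ⟨n * Ideal.absNorm J, mul_ne_zero hn (by exact_mod_cast hN), ?_⟩
  refine ⟨⟨n • y, hy⟩ * (Ideal.absNorm J : 𝓞 F),
    Ideal.mul_mem_left _ _ (Ideal.absNorm_mem J), ?_⟩
  change (n • y) * ((Ideal.absNorm J : 𝓞 F) : F) = _
  simp [mul_smul]
  ring

/-- A `u`-stable `K` is stable under `ℤ + ℤ u`, which contains `N` times the ring of integers; so
`N` carries the ideal generated by `K` into `K`. -/
theorem smul_mem_of_stable (u : 𝓞 F) {N : ℤ}
    (hN : ∀ o : 𝓞 F, ∃ a b : ℤ, N • o = a • (1 : 𝓞 F) + b • u) {K : AddSubgroup (𝓞 F)}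
    (hK : ∀ x ∈ K, u * x ∈ K) {x : 𝓞 F} (hx : x ∈ Ideal.span (K : Set (𝓞 F))) : N • x ∈ K := by
  suffices h : ∀ o : 𝓞 F, N • (o * x) ∈ K by simpa using h 1
  induction hx using Submodule.span_induction with
  | mem x hx =>
    intro o
    obtain ⟨a, b, h⟩ := hN o
    rw [← smul_mul_assoc, h, add_mul, smul_mul_assoc, smul_mul_assoc, one_mul]
    exact add_mem (K.zsmul_mem hx a) (K.zsmul_mem (hK x hx) b)
  | zero => simp
  | add x y _ _ hx hy =>
    intro o
    rw [mul_add, smul_add]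
    exact add_mem (hx o) (hy o)
  | smul o' x _ hx =>
    intro o
    rw [smul_eq_mul, ← mul_assoc]
    exact hx (o * o')

/-- A subgroup stable under a non-rational integer `u` has bounded index in the ideal that it
generates. -/
theorem relIndex_le_of_stable (u : 𝓞 F) {N : ℤ} (hN0 : N ≠ 0)
    (hN : ∀ o : 𝓞 F, ∃ a b : ℤ, N • o = a • (1 : 𝓞 F) + b • u) {J : Ideal (𝓞 F)} (hJ : J ≠ ⊥)
    {f : ℕ} {K : AddSubgroup (𝓞 F)} (hK : K ∈ primitiveSubgroups J f)
    (hst : ∀ x ∈ K, u * x ∈ K) : f ≤ Ideal.absNorm (Ideal.span {(N : 𝓞 F)}) := by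
  have hle : (Ideal.span {(N : 𝓞 F)} * J).toAddSubgroup ≤ K := by
    intro x hx
    rw [Submodule.mem_toAddSubgroup, Ideal.mem_span_singleton_mul] at hx
    obtain ⟨z, hz, rfl⟩ := hx
    rw [← hK.1] at hz
    have := smul_mem_of_stable u hN hst hz
    rwa [zsmul_eq_mul] at this
  have hd := AddSubgroup.relIndex_dvd_of_le_left J.toAddSubgroup hle
  rw [relIndex_mul_ideal _ hJ, hK.2] at hd
  refine Nat.le_of_dvd (Nat.pos_of_ne_zero ?_) hd
  rw [Ne, Ideal.absNorm_eq_zero_iff, Ideal.span_singleton_eq_bot]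
  exact_mod_cast hN0

/-- `1` and `u` form a ℚ-basis of `F`; `N` is a common denominator for the coordinates of an
integral basis. -/
theorem exists_smul_eq_add_smul (hF : Module.finrank ℚ F = 2) {u : 𝓞 F}
    (hu : ∀ q : ℚ, (u : F) ≠ algebraMap ℚ F q) :
    ∃ N : ℤ, N ≠ 0 ∧ ∀ o : 𝓞 F, ∃ a b : ℤ, N • o = a • (1 : 𝓞 F) + b • u := by
  have hli : LinearIndependent ℚ ![(1 : F), (u : F)] := by
    rw [LinearIndependent.pair_iff]
    intro s t hst
    have ht : t = 0 := by
      by_contra ht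
      refine hu (-s / t) ?_
      have ht' : algebraMap ℚ F t ≠ 0 := by simpa using ht
      rw [Algebra.smul_def, Algebra.smul_def] at hst
      rw [map_div₀, eq_div_iff ht', map_neg]
      linear_combination hst
    subst ht
    simpa using hst
  let B := basisOfLinearIndependentOfCardEqFinrank hli (by simp [hF])
  have hB : ∀ y : F, ∃ q r : ℚ, y = q • (1 : F) + r • (u : F) := fun y => by
    refine ⟨B.repr y 0, B.repr y 1, ?_⟩
    conv_lhs => rw [← B.sum_repr y]
    simp [Fin.sum_univ_two, B]
  choose q r hqr using hB
  let ω := RingOfIntegers.basis F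
  obtain ⟨N, hN⟩ := IsLocalization.exist_integer_multiples (nonZeroDivisors ℤ)
    (Finset.univ : Finset (Module.Free.ChooseBasisIndex ℤ (𝓞 F) ⊕
      Module.Free.ChooseBasisIndex ℤ (𝓞 F)))
    (Sum.elim (fun i => q (ω i : 𝓞 F)) (fun i => r (ω i : 𝓞 F)))
  choose z hz using fun i => hN i (Finset.mem_univ _)
  refine ⟨N, nonZeroDivisors.coe_ne_zero N, fun o => ?_⟩
  have hω : ∀ i, (N : ℤ) • ω i = z (Sum.inl i) • (1 : 𝓞 F) + z (Sum.inr i) • u := fun i => by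
    apply RingOfIntegers.coe_injective
    have h1 := hz (Sum.inl i)
    have h2 := hz (Sum.inr i)
    simp only [Sum.elim_inl, Sum.elim_inr, algebraMap_int_eq, eq_intCast] at h1 h2
    have h3 := hqr (ω i : 𝓞 F)
    rw [map_zsmul, map_add, map_zsmul, map_zsmul, map_one]
    change (N : ℤ) • ((ω i : 𝓞 F) : F) = _ + _ • (u : F)
    rw [h3, smul_add, ← smul_assoc, ← smul_assoc, Algebra.smul_def ((N : ℤ) • q _),
      Algebra.smul_def ((N : ℤ) • r _)]
    have e1 : ((N : ℤ) • q (ω i : 𝓞 F) : ℚ) = (z (Sum.inl i) : ℚ) := h1.symm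
    have e2 : ((N : ℤ) • r (ω i : 𝓞 F) : ℚ) = (z (Sum.inr i) : ℚ) := h2.symm
    rw [e1, e2]
    simp
  refine ⟨∑ i, ω.repr o i * z (Sum.inl i), ∑ i, ω.repr o i * z (Sum.inr i), ?_⟩
  conv_lhs => rw [← ω.sum_repr o]
  rw [Finset.smul_sum, Finset.sum_smul, Finset.sum_smul, ← Finset.sum_add_distrib]
  refine Finset.sum_congr rfl fun i _ => ?_
  rw [smul_comm, hω, smul_add, mul_smul, mul_smul]

/-- The number of primitive sublattices of index `f` stable under a nontrivial rotation
vanishes for large `f`. -/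
theorem exists_bound_of_rotation (hF : Module.finrank ℚ F = 2)
    (hN : ∀ x : F, 0 ≤ Algebra.norm ℚ x) :
    ∃ C : ℕ, ∀ u : 𝓞 F, Algebra.norm ℚ (u : F) = 1 → u ≠ 1 → u ≠ -1 → ∀ J : Ideal (𝓞 F), J ≠ ⊥ →
      ∀ (f : ℕ) (K : AddSubgroup (𝓞 F)), K ∈ primitiveSubgroups J f →
        (∀ x ∈ K, u * x ∈ K) → f ≤ C := by
  have hfin : {u : 𝓞 F | Algebra.norm ℚ (u : F) = 1}.Finite := by
    refine ((finite_setOf_isIntegral_norm_eq hF hN 1).preimage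
      (RingOfIntegers.coe_injective (K := F)).injOn).subset fun u hu => ?_
    exact ⟨u.isIntegral_coe, hu⟩
  have hb : ∀ u : 𝓞 F, ∃ C : ℕ, Algebra.norm ℚ (u : F) = 1 → u ≠ 1 → u ≠ -1 →
      ∀ J : Ideal (𝓞 F), J ≠ ⊥ → ∀ (f : ℕ) (K : AddSubgroup (𝓞 F)), K ∈ primitiveSubgroups J f →
        (∀ x ∈ K, u * x ∈ K) → f ≤ C := by
    intro u
    by_cases h : Algebra.norm ℚ (u : F) = 1 ∧ u ≠ 1 ∧ u ≠ -1
    · obtain ⟨N, hN0, hN⟩ := exists_smul_eq_add_smul hF (u := u) (by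
        intro q hq
        have h1 := h.1
        rw [hq, norm_algebraMap_of_finrank_two hF] at h1
        rcases (by simpa using h1 : q = 1 ∨ q = -1) with rfl | rfl
        · exact h.2.1 (RingOfIntegers.coe_injective (by simpa using hq))
        · exact h.2.2 (RingOfIntegers.coe_injective (by simpa using hq)))
      exact ⟨_, fun _ _ _ J hJ f K hK hst => relIndex_le_of_stable u hN0 hN hJ hK hst⟩
    · exact ⟨0, fun h1 h2 h3 => absurd ⟨h1, h2, h3⟩ h⟩
  choose C hC using hb
  -- Only finitely many integers have norm one, so the sum of their bounds serves all of them at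
  -- once.
  refine ⟨∑ u ∈ hfin.toFinset, C u, fun u h1 h2 h3 J hJ f K hK hst => ?_⟩
  exact (hC u h1 h2 h3 J hJ f K hK hst).trans
    (Finset.single_le_sum (f := C) (fun _ _ => Nat.zero_le _) (hfin.mem_toFinset.2 h1))

/-- The primitive sublattices of index `f` of `J` that are fixed by `g`. -/
def fixedPrimitive (g : F ≃ₗ[ℚ] F) (J : Ideal (𝓞 F)) (f : ℕ) : Set (AddSubgroup (𝓞 F)) :=
  {K | K ∈ primitiveSubgroups J f ∧ image g (latticeOf K) = latticeOf K}

/-- The restriction of `g` to a stable ideal. -/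
theorem exists_restriction {g : F ≃ₗ[ℚ] F} {J : Ideal (𝓞 F)}
    (hgJ : image g (latticeOf J.toAddSubgroup) = latticeOf J.toAddSubgroup) :
    ∃ h : J →ₗ[ℤ] J, ∀ x : J, ((h x : 𝓞 F) : F) = g (x : 𝓞 F) := by
  have hex : ∀ x : J, ∃ y : J, ((y : 𝓞 F) : F) = g (x : 𝓞 F) := fun x => by
    have : g (x : 𝓞 F) ∈ latticeOf J.toAddSubgroup := by
      rw [← hgJ]; exact ⟨_, ⟨x, x.2, rfl⟩, rfl⟩
    obtain ⟨y, hy, e⟩ := this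
    exact ⟨⟨y, hy⟩, e⟩
  choose h hh using hex
  let h' : J →+ J :=
    { toFun := h
      map_zero' := by
        apply Subtype.ext; apply RingOfIntegers.coe_injective
        change ((h 0 : 𝓞 F) : F) = _
        rw [hh]; simp
      map_add' := fun x y => by
        apply Subtype.ext; apply RingOfIntegers.coe_injective
        change ((h (x + y) : 𝓞 F) : F) = ((h x : 𝓞 F) : F) + ((h y : 𝓞 F) : F)
        rw [hh, hh, hh, ← map_add]; rfl }
  exact ⟨h'.toIntLinearMap, hh⟩

/-- `g` restricts to an involution of the rank-two lattice `J`. Since `J` spans `F` over ℚ, the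
restriction is still different from `±1`, and the count for involutions applies. -/
theorem ncard_fixedPrimitive_involution_le (hF : Module.finrank ℚ F = 2) {g : F ≃ₗ[ℚ] F}
    (hg2 : ∀ x, g (g x) = x) (hg1 : g ≠ 1) (hgn : g ≠ LinearEquiv.neg ℚ) {J : Ideal (𝓞 F)} (hJ : J ≠ ⊥)
    (hgJ : image g (latticeOf J.toAddSubgroup) = latticeOf J.toAddSubgroup) {f : ℕ} (hf : f ≠ 0) :
    (fixedPrimitive g J f).ncard ≤ 2 * f.divisors.card := by
  obtain ⟨h, hh⟩ := exists_restriction hgJ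
  have hinj : ∀ x y : J, ((x : 𝓞 F) : F) = ((y : 𝓞 F) : F) → x = y := fun x y e =>
    Subtype.ext (RingOfIntegers.coe_injective e)
  have h2 : ∀ x, h (h x) = x := fun x => hinj _ _ (by rw [hh, hh, hg2])
  have hext : ∀ σ : F ≃ₗ[ℚ] F, (∀ x : J, g (x : 𝓞 F) = σ (x : 𝓞 F)) → g = σ := by
    intro σ hσ
    ext y
    obtain ⟨n, hn, hy⟩ := exists_smul_mem_latticeOf hJ y
    obtain ⟨x, hx, e⟩ := hy
    have h3 := hσ ⟨x, hx⟩
    change g (algebraMap (𝓞 F) F x) = σ (algebraMap (𝓞 F) F x) at h3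
    rw [show algebraMap (𝓞 F) F x = n • y from e, map_zsmul, map_zsmul] at h3
    exact smul_right_injective F hn h3
  have hne1 : ∃ x, h x ≠ x := by
    by_contra hcon
    push Not at hcon
    exact hg1 (hext 1 fun x => by rw [← hh, hcon]; rfl)
  have hne2 : ∃ x, h x ≠ -x := by
    by_contra hcon
    push Not at hcon
    exact hgn (hext (LinearEquiv.neg ℚ) fun x => by rw [← hh, hcon]; simp)
  refine le_trans ?_ (ncard_stable_involution_le (idealBasis hF hJ) h h2 hne1 hne2 hf)
  have hfin : {K : AddSubgroup J | K.index = f ∧ ∀ x ∈ K, h x ∈ K}.Finite :=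
    (finite_setOf_index_eq_of_equiv (coordEquiv (idealBasis hF hJ)) hf).subset fun K hK => hK.1
  refine Set.ncard_le_ncard_of_injOn (fun K => K.comap (Submodule.subtype J).toAddMonoidHom)
    ?_ ?_ hfin
  · rintro K ⟨hK, hgK⟩
    refine ⟨hK.2, fun x hx => ?_⟩
    have : g (x : 𝓞 F) ∈ latticeOf K := by
      rw [← hgK]; exact ⟨_, ⟨x, hx, rfl⟩, rfl⟩
    rw [← hh] at this
    exact coe_mem_latticeOf.1 this
  · rintro K ⟨hK, -⟩ K' ⟨hK', -⟩ e
    have hle := le_of_mem_primitiveSubgroups hK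
    have hle' := le_of_mem_primitiveSubgroups hK'
    ext x
    constructor
    · intro hx
      have : (⟨x, hle hx⟩ : J) ∈ K.comap (Submodule.subtype J).toAddMonoidHom := hx
      exact (SetLike.ext_iff.1 e _).1 this
    · intro hx
      have : (⟨x, hle' hx⟩ : J) ∈ K'.comap (Submodule.subtype J).toAddMonoidHom := hx
      exact (SetLike.ext_iff.1 e _).2 this

/-- Norm-preserving maps other than `±1` fix few primitive sublattices. -/
theorem exists_ncard_fixedPrimitive_le (hF : Module.finrank ℚ F = 2)
    (hN : ∀ x : F, 0 ≤ Algebra.norm ℚ x) :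
    ∃ C : ℕ, ∀ g : F ≃ₗ[ℚ] F, (∀ x, Algebra.norm ℚ (g x) = Algebra.norm ℚ x) → g ≠ 1 → g ≠ LinearEquiv.neg ℚ →
      ∀ J : Ideal (𝓞 F), J ≠ ⊥ →
        image g (latticeOf J.toAddSubgroup) = latticeOf J.toAddSubgroup →
        ∀ f : ℕ, f ≠ 0 → (fixedPrimitive g J f).ncard ≤ C * f.divisors.card := by
  obtain ⟨B, hB⟩ := exists_bound_of_rotation hF hN
  -- The `2` serves the reflections. The sum serves the rotations: for `f ≤ B` the fixed sublattices
  -- are at most all `σ₁(f)` of them, and for `f > B` there are none.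
  refine ⟨2 + ∑ f ∈ Finset.range (B + 1), ∑ d ∈ f.divisors, d, ?_⟩
  intro g hg hg1 hgn J hJ hgJ f hf
  have hdpos : 1 ≤ f.divisors.card :=
    Finset.card_pos.2 ⟨1, by simp [hf]⟩
  obtain ⟨c, hc⟩ := exists_eq_mul_algEquiv hF g hg
  by_cases hc1 : c = 1
  · subst hc1
    have hgx : ∀ x, g x = g 1 * x := fun x => hc x
    have hu : Algebra.norm ℚ (g 1) = 1 := by rw [hg]; exact map_one _
    -- Multiplication by `g 1` maps the nonzero finitely generated lattice `J` into itself.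
    have hint : IsIntegral ℤ (g 1) := by
      refine isIntegral_of_smul_mem_submodule (M := F) (latticeOf J.toAddSubgroup) ?_ ?_ (g 1) ?_
      · intro h0
        obtain ⟨x, hx, hx0⟩ := Submodule.exists_mem_ne_zero_of_ne_bot hJ
        have : (x : F) ∈ latticeOf J.toAddSubgroup := ⟨x, hx, rfl⟩
        rw [h0, Submodule.mem_bot] at this
        exact hx0 (RingOfIntegers.coe_injective (by simpa using this))
      · have hfg : (J.restrictScalars ℤ).FG := Module.Finite.iff_fg.1
          (Module.Finite.of_basis (idealBasis hF hJ))
        exact hfg.map (Algebra.linearMap (𝓞 F) F |>.restrictScalars ℤ)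
      · intro n hn
        rw [smul_eq_mul, ← hgx, ← hgJ]
        exact ⟨n, hn, rfl⟩
    let u : 𝓞 F := ⟨g 1, hint⟩
    have huF : (u : F) = g 1 := rfl
    by_cases hfB : f ≤ B
    · calc (fixedPrimitive g J f).ncard ≤ ∑ d ∈ f.divisors, d := by
            rw [← ncard_subgroupsOfIndex hF hJ hf]
            exact Set.ncard_le_ncard
              (fun K hK => primitiveSubgroups_subset J f hK.1) (finite_subgroupsOfIndex hF hJ hf)
        _ ≤ ∑ f ∈ Finset.range (B + 1), ∑ d ∈ f.divisors, d :=
            Finset.single_le_sum (f := fun f : ℕ => ∑ d ∈ f.divisors, d)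
              (fun _ _ => Nat.zero_le _) (Finset.mem_range.2 (by omega))
        _ ≤ (2 + ∑ f ∈ Finset.range (B + 1), ∑ d ∈ f.divisors, d) * 1 := by omega
        _ ≤ _ := Nat.mul_le_mul_left _ hdpos
    · have : fixedPrimitive g J f = ∅ := by
        refine Set.eq_empty_of_forall_notMem fun K hK => hfB ?_
        refine hB u hu ?_ ?_ J hJ f K hK.1 fun x hx => ?_
        · intro h
          refine hg1 (LinearEquiv.ext fun x => ?_)
          rw [hgx, ← huF, h]; simp
        · intro h
          refine hgn (LinearEquiv.ext fun x => ?_)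
          rw [hgx, ← huF, h]; simp
        · have : g x ∈ latticeOf K := by
            rw [← hK.2]; exact ⟨_, ⟨x, hx, rfl⟩, rfl⟩
          rw [hgx, ← huF] at this
          exact coe_mem_latticeOf.1 this
      rw [this, Set.ncard_empty]
      exact Nat.zero_le _
  · refine (ncard_fixedPrimitive_involution_le hF (apply_apply_of_ne_one hF hg hc hc1) hg1 hgn
      hJ hgJ hf).trans (Nat.mul_le_mul_right _ (by omega))

/-- A nonzero ideal has finitely many norm-preserving linear automorphisms. -/
theorem finite_norm_preserving_stabilizer (hF : Module.finrank ℚ F = 2)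
    (hN : ∀ x : F, 0 ≤ Algebra.norm ℚ x) {J : Ideal (𝓞 F)} (hJ : J ≠ ⊥) :
    {g : F ≃ₗ[ℚ] F | (∀ x, Algebra.norm ℚ (g x) = Algebra.norm ℚ x) ∧
      image g (latticeOf J.toAddSubgroup) = latticeOf J.toAddSubgroup}.Finite := by
  obtain ⟨x, hx, hx0⟩ := Submodule.exists_mem_ne_zero_of_ne_bot hJ
  have hxF : (x : F) ≠ 0 := fun h => hx0 (RingOfIntegers.coe_injective (by simpa using h))
  set W := {y : F | IsIntegral ℤ y ∧ Algebra.norm ℚ y = Algebra.norm ℚ (x : F)}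
  have hW : W.Finite := finite_setOf_isIntegral_norm_eq hF hN _
  choose c hc using fun g : {g : F ≃ₗ[ℚ] F // ∀ x, Algebra.norm ℚ (g x) = Algebra.norm ℚ x} =>
    exists_eq_mul_algEquiv hF g.1 g.2
  have := hW.to_subtype
  rw [← Set.finite_coe_iff]
  -- Since `g x = g 1 * c x`, the automorphism `c` and the value at one nonzero `x ∈ J` determine
  -- `g`; that value lies in the finite set of integers with the norm of `x`.
  refine Finite.of_injective (β := (F ≃ₐ[ℚ] F) × W) (fun g => (c ⟨g.1, g.2.1⟩, ⟨g.1 x, ?_, ?_⟩)) ?_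
  · have : g.1 (x : F) ∈ latticeOf J.toAddSubgroup :=
      g.2.2.le ⟨_, ⟨x, hx, rfl⟩, rfl⟩
    obtain ⟨y, -, e⟩ := this
    rw [← e]
    exact y.isIntegral_coe
  · exact g.2.1 _
  · rintro ⟨g, hg⟩ ⟨g', hg'⟩ e
    simp only [Prod.mk.injEq, Subtype.mk.injEq] at e ⊢
    obtain ⟨e1, e2⟩ := e
    have h1 := hc ⟨g, hg.1⟩
    have h2 := hc ⟨g', hg'.1⟩
    rw [e1] at h1
    simp only at h1 h2
    have h3 : g 1 = g' 1 := by
      rw [h1 (x : F), h2 (x : F)] at e2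
      exact mul_right_cancel₀ (by simpa using hx0) e2
    refine LinearEquiv.ext fun y => ?_
    rw [h1, h2, h3]

end FixedLattices

/-! ### Classes of sublattices and Burnside's formula -/

section Orbits

set_option linter.unusedSectionVars false

variable {F : Type*} [Field F] [NumberField F]

/-- The elements of `G` that preserve the ideal `J`. -/
def idealStabilizer (G : Subgroup (F ≃ₗ[ℚ] F)) (J : Ideal (𝓞 F)) : Subgroup (F ≃ₗ[ℚ] F) where
  carrier := {g | g ∈ G ∧ image g (latticeOf J.toAddSubgroup) = latticeOf J.toAddSubgroup}
  one_mem' := ⟨G.one_mem, image_one _⟩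
  mul_mem' := fun ha hb => ⟨G.mul_mem ha.1 hb.1, by rw [image_mul, hb.2, ha.2]⟩
  inv_mem' := fun {g} hg => ⟨G.inv_mem hg.1, by
    conv_lhs => rw [← hg.2]
    rw [← image_mul, inv_mul_cancel, image_one]⟩

theorem image_neg {V : Type*} [AddCommGroup V] [Module ℚ V] (K : Submodule ℤ V) :
    image (LinearEquiv.neg ℚ) K = K := by
  ext x
  rw [mem_image]
  constructor
  · rintro ⟨k, hk, rfl⟩
    simpa using hk
  · intro hx
    exact ⟨-x, by simpa using hx, by simp⟩

/-- A subgroup of linear automorphisms of `F` between the multiplications by elements of norm one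
and the norm-preserving maps. -/
structure IsNormGroup (G : Subgroup (F ≃ₗ[ℚ] F)) : Prop where
  norm_apply : ∀ g ∈ G, ∀ x, Algebra.norm ℚ (g x) = Algebra.norm ℚ x
  mul_mem : ∀ u : F, Algebra.norm ℚ u = 1 → ∀ g : F ≃ₗ[ℚ] F, (∀ x, g x = u * x) → g ∈ G

variable {G : Subgroup (F ≃ₗ[ℚ] F)}

theorem IsNormGroup.neg_mem (hG : IsNormGroup G) (hF : Module.finrank ℚ F = 2) :
    LinearEquiv.neg ℚ ∈ G := by
  refine hG.mul_mem (-1) ?_ _ fun x => by simp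
  have := norm_algebraMap_of_finrank_two hF (-1)
  simpa using this

theorem IsNormGroup.finite_idealStabilizer (hG : IsNormGroup G) (hF : Module.finrank ℚ F = 2)
    (hN : ∀ x : F, 0 ≤ Algebra.norm ℚ x) {J : Ideal (𝓞 F)} (hJ : J ≠ ⊥) :
    Finite (idealStabilizer G J) :=
  ((finite_norm_preserving_stabilizer hF hN hJ).subset
    fun g hg => ⟨hG.norm_apply g hg.1, hg.2⟩).to_subtype

/-- The primitive sublattices of `J` of index `f`, as submodules of `F`. -/
def primitiveLattices (J : Ideal (𝓞 F)) (f : ℕ) : Set (Submodule ℤ F) :=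
  latticeOf '' primitiveSubgroups J f

/-- Norm-preserving maps transport primitive sublattices. -/
theorem image_mem_primitiveLattices (hF : Module.finrank ℚ F = 2) {g : F ≃ₗ[ℚ] F}
    (hg : ∀ x, Algebra.norm ℚ (g x) = Algebra.norm ℚ x) {J J' : Ideal (𝓞 F)}
    (h : image g (latticeOf J.toAddSubgroup) = latticeOf J'.toAddSubgroup) {f : ℕ}
    {M : Submodule ℤ F} (hM : M ∈ primitiveLattices J f) : image g M ∈ primitiveLattices J' f := by
  obtain ⟨K, hK, rfl⟩ := hM
  have hle : image g (latticeOf K) ≤ latticeOf J'.toAddSubgroup := by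
    rw [← h]
    exact image_le_image g (latticeOf_le_iff.2 (le_of_mem_primitiveSubgroups hK))
  obtain ⟨K', -, hK'⟩ := exists_eq_latticeOf hle
  refine ⟨K', ⟨?_, ?_⟩, hK'.symm⟩
  · have := image_latticeOf_span hF hg hK'
    rw [hK.1, h] at this
    exact Submodule.toAddSubgroup_injective (latticeOf_injective this.symm)
  · rw [← relIndex_latticeOf, ← hK', ← h, relIndex_image, relIndex_latticeOf, hK.2]

/-- A lattice determines the ideal that it generates and its index there, and `g` respects both.
Hence equivalent primitive sublattices have equivalent ideals, and a `g` relating two primitive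
sublattices of one `J` stabilizes `J`. -/
theorem image_eq_of_primitiveLattices (hF : Module.finrank ℚ F = 2) {g : F ≃ₗ[ℚ] F}
    (hg : ∀ x, Algebra.norm ℚ (g x) = Algebra.norm ℚ x) {J J' : Ideal (𝓞 F)} {f f' : ℕ}
    {M : Submodule ℤ F} (hM : M ∈ primitiveLattices J f)
    (hM' : image g M ∈ primitiveLattices J' f') :
    image g (latticeOf J.toAddSubgroup) = latticeOf J'.toAddSubgroup ∧ f = f' := by
  obtain ⟨K, hK, rfl⟩ := hM
  obtain ⟨K', hK', e⟩ := hM'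
  have h := image_latticeOf_span hF hg e.symm
  rw [hK.1, hK'.1] at h
  refine ⟨h, ?_⟩
  rw [← hK.2, ← hK'.2, ← relIndex_latticeOf, ← relIndex_latticeOf, e, ← h, relIndex_image]

theorem finite_primitiveLattices (hF : Module.finrank ℚ F = 2) {J : Ideal (𝓞 F)} (hJ : J ≠ ⊥)
    {f : ℕ} (hf : f ≠ 0) : (primitiveLattices J f).Finite :=
  (finite_primitiveSubgroups hF hJ hf).image _

/-- The action of the stabilizer of `J` on the primitive sublattices of `J`. -/
@[reducible]
noncomputable def stabilizerAction (hG : IsNormGroup G) (hF : Module.finrank ℚ F = 2)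
    (J : Ideal (𝓞 F)) (f : ℕ) : MulAction (idealStabilizer G J) (primitiveLattices J f) where
  smul g M := ⟨image g.1 M.1,
    image_mem_primitiveLattices hF (hG.norm_apply g.1 g.2.1) g.2.2 M.2⟩
  one_smul M := Subtype.ext (image_one M.1)
  mul_smul g h M := Subtype.ext (image_mul g.1 h.1 M.1)

/-- Burnside's formula for the number of classes of primitive sublattices of `J`. -/
theorem sum_ncard_fixed_eq (hG : IsNormGroup G) (hF : Module.finrank ℚ F = 2)
    {J : Ideal (𝓞 F)} (hJ : J ≠ ⊥) {f : ℕ} (hf : f ≠ 0) [Fintype (idealStabilizer G J)] :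
    ∑ g : idealStabilizer G J, (fixedPrimitive g.1 J f).ncard =
      (cls G '' primitiveLattices J f).ncard * Nat.card (idealStabilizer G J) := by
  classical
  let := stabilizerAction hG hF J f
  have hfin := finite_primitiveLattices hF hJ hf
  have : Fintype (primitiveLattices J f) := hfin.fintype
  have hB := MulAction.sum_card_fixedBy_eq_card_orbits_mul_card_group (idealStabilizer G J)
    (primitiveLattices J f)
  have hsmul : ∀ (g : idealStabilizer G J) (M : primitiveLattices J f),
      (g • M).1 = image g.1 M.1 := fun _ _ => rfl
  have h1 : ∀ g : idealStabilizer G J,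
      Fintype.card (MulAction.fixedBy (primitiveLattices J f) g) =
        (fixedPrimitive g.1 J f).ncard := by
    intro g
    rw [← Nat.card_eq_fintype_card, Nat.card_coe_set_eq,
      ← Set.ncard_image_of_injective _ Subtype.val_injective,
      ← Set.ncard_image_of_injective (fixedPrimitive g.1 J f) latticeOf_injective]
    congr 1
    ext M
    constructor
    · rintro ⟨⟨M, K, hK, rfl⟩, hM, rfl⟩
      rw [MulAction.mem_fixedBy, Subtype.ext_iff, hsmul] at hM
      exact ⟨K, ⟨hK, hM⟩, rfl⟩
    · rintro ⟨K, ⟨hK, hgK⟩, rfl⟩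
      refine ⟨⟨latticeOf K, K, hK, rfl⟩, ?_, rfl⟩
      rw [MulAction.mem_fixedBy, Subtype.ext_iff, hsmul]
      exact hgK
  have h2 : Fintype.card (Quotient (MulAction.orbitRel (idealStabilizer G J)
      (primitiveLattices J f))) = (cls G '' primitiveLattices J f).ncard := by
    rw [← Nat.card_eq_fintype_card]
    -- On primitive sublattices of `J`, equivalence under all of `G` is equivalence under the
    -- stabilizer, because the relating element must preserve `J`.
    have hker : MulAction.orbitRel (idealStabilizer G J) (primitiveLattices J f) =
        Setoid.ker (fun M : primitiveLattices J f => cls G M.1) := by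
      ext M M'
      rw [MulAction.orbitRel_apply, Setoid.ker_def, eq_comm, cls_eq_iff, MulAction.mem_orbit_iff]
      constructor
      · rintro ⟨g, rfl⟩
        exact ⟨g.1, g.2.1, rfl⟩
      · rintro ⟨g, hg, e⟩
        have hgJ := (image_eq_of_primitiveLattices hF (hG.norm_apply g hg) M'.2
          (e ▸ M.2 : image g M'.1 ∈ primitiveLattices J f)).1
        exact ⟨⟨g, hg, hgJ⟩, Subtype.ext e⟩
    rw [hker, Nat.card_congr (Setoid.quotientKerEquivRange _), Nat.card_coe_set_eq,
      Set.image_eq_range]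
  rw [h2, Finset.sum_congr rfl fun g _ => h1 g] at hB
  rw [hB, Nat.card_eq_fintype_card]

theorem one_ne_neg : (1 : F ≃ₗ[ℚ] F) ≠ LinearEquiv.neg ℚ := by
  intro h
  have := LinearEquiv.congr_fun h 1
  simp only [LinearEquiv.coe_one, id_eq, LinearEquiv.neg_apply] at this
  have h2 : (2 : F) = 0 := by linear_combination this
  exact two_ne_zero h2

/-- The number of classes of primitive sublattices of `J` is close to the average contribution of
`±1`. -/
theorem exists_classes_bound (hF : Module.finrank ℚ F = 2)
    (hN : ∀ x : F, 0 ≤ Algebra.norm ℚ x) :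
    ∃ C : ℕ, ∀ G : Subgroup (F ≃ₗ[ℚ] F), IsNormGroup G → ∀ J : Ideal (𝓞 F), J ≠ ⊥ →
      2 ≤ Nat.card (idealStabilizer G J) ∧ ∀ f : ℕ, f ≠ 0 →
      |((cls G '' primitiveLattices J f).ncard : ℝ) -
        2 / Nat.card (idealStabilizer G J) * primitiveCount F f| ≤ C * f.divisors.card := by
  classical
  obtain ⟨C, hC⟩ := exists_ncard_fixedPrimitive_le hF hN
  refine ⟨C, fun G hG J hJ => ?_⟩
  have := hG.finite_idealStabilizer hF hN hJ
  have : Fintype (idealStabilizer G J) := Fintype.ofFinite _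
  let e₁ : idealStabilizer G J := 1
  let e₂ : idealStabilizer G J := ⟨LinearEquiv.neg ℚ, hG.neg_mem hF, image_neg _⟩
  have hne : e₁ ≠ e₂ := fun h => one_ne_neg (congrArg Subtype.val h)
  have hcard : 2 ≤ Nat.card (idealStabilizer G J) := by
    rw [Nat.card_eq_fintype_card, ← Finset.card_pair hne]
    exact Finset.card_le_univ _
  refine ⟨hcard, fun f hf => ?_⟩
  have hB := sum_ncard_fixed_eq hG hF hJ hf
  rw [← Finset.sum_sdiff (Finset.subset_univ {e₁, e₂}), Finset.sum_pair hne] at hB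
  have hfix : ∀ g : F ≃ₗ[ℚ] F, (∀ K : Submodule ℤ F, image g K = K) →
      (fixedPrimitive g J f).ncard = primitiveCount F f := by
    intro g hg
    rw [← ncard_primitiveSubgroups hF hf hJ]
    congr 1
    ext K
    exact ⟨fun h => h.1, fun h => ⟨h, hg _⟩⟩
  -- `±1` fix every lattice and give the main term; what remains in the Burnside sum is the error.
  rw [hfix e₁.1 image_one, hfix e₂.1 image_neg] at hB
  have hle : ∑ g ∈ Finset.univ \ {e₁, e₂}, (fixedPrimitive g.1 J f).ncard ≤
      Nat.card (idealStabilizer G J) * (C * f.divisors.card) := by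
    refine (Finset.sum_le_card_nsmul _ _ (C * f.divisors.card) fun g hg => ?_).trans ?_
    · simp only [Finset.mem_sdiff, Finset.mem_univ, true_and, Finset.mem_insert,
        Finset.mem_singleton, not_or] at hg
      exact hC g.1 (hG.norm_apply g.1 g.2.1) (fun h => hg.1 (Subtype.ext h))
        (fun h => hg.2 (Subtype.ext h)) J hJ g.2.2 f hf
    · rw [smul_eq_mul, Nat.card_eq_fintype_card]
      exact Nat.mul_le_mul_right _ (Finset.card_le_univ _)
  set s : ℝ := (Nat.card (idealStabilizer G J) : ℝ) with hs
  have hs0 : 0 < s := by rw [hs]; exact_mod_cast (by omega : 0 < Nat.card (idealStabilizer G J))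
  set R := ∑ g ∈ Finset.univ \ {e₁, e₂}, (fixedPrimitive g.1 J f).ncard
  have hBr : (R : ℝ) + 2 * primitiveCount F f = (cls G '' primitiveLattices J f).ncard * s := by
    rw [hs, ← Nat.cast_mul, ← hB]; push_cast; ring
  have hRr : (R : ℝ) ≤ s * (C * f.divisors.card) := by rw [hs]; exact_mod_cast hle
  have e : ((cls G '' primitiveLattices J f).ncard : ℝ) - 2 / s * primitiveCount F f = R / s := by
    field_simp
    linarith
  rw [e, abs_of_nonneg (by positivity), div_le_iff₀ hs0]
  linarith

/-- The classes of the ideals contained in `I` with index `n`. -/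
noncomputable def idealClasses (G : Subgroup (F ≃ₗ[ℚ] F)) (I : Ideal (𝓞 F)) (n : ℕ) :
    Finset (Set (Submodule ℤ F)) :=
  open scoped Classical in
  (idealsOfNorm F n).image fun a => cls G (latticeOf (a * I).toAddSubgroup)

theorem mem_idealClasses {I : Ideal (𝓞 F)} {n : ℕ} {c : Set (Submodule ℤ F)} :
    c ∈ idealClasses G I n ↔
      ∃ a : Ideal (𝓞 F), Ideal.absNorm a = n ∧ cls G (latticeOf (a * I).toAddSubgroup) = c := by
  simp [idealClasses]

open scoped Classical in
/-- An ideal `a` of norm `n` such that `a * I` lies in the class `c`. -/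
noncomputable def classCofactor (G : Subgroup (F ≃ₗ[ℚ] F)) (I : Ideal (𝓞 F)) (n : ℕ)
    (c : Set (Submodule ℤ F)) : Ideal (𝓞 F) :=
  if h : ∃ a : Ideal (𝓞 F), Ideal.absNorm a = n ∧ cls G (latticeOf (a * I).toAddSubgroup) = c
  then h.choose else ⊤

theorem classCofactor_spec {I : Ideal (𝓞 F)} {n : ℕ} {c : Set (Submodule ℤ F)}
    (hc : c ∈ idealClasses G I n) : Ideal.absNorm (classCofactor G I n c) = n ∧
      cls G (latticeOf (classCofactor G I n c * I).toAddSubgroup) = c := by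
  have h := mem_idealClasses.1 hc
  rw [classCofactor, dif_pos h]
  exact h.choose_spec

/-- Ideals of equal norm in the same ideal class are equivalent under multiplication by an element
of norm one. -/
theorem cls_eq_of_mk0_eq (hG : IsNormGroup G)
    (hN : ∀ x : F, 0 ≤ Algebra.norm ℚ x) {J J' : Ideal (𝓞 F)}
    (hJ : J ∈ nonZeroDivisors (Ideal (𝓞 F))) (hJ' : J' ∈ nonZeroDivisors (Ideal (𝓞 F)))
    (hn : Ideal.absNorm J = Ideal.absNorm J')
    (h : ClassGroup.mk0 ⟨J, hJ⟩ = ClassGroup.mk0 ⟨J', hJ'⟩) :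
    cls G (latticeOf J.toAddSubgroup) = cls G (latticeOf J'.toAddSubgroup) := by
  -- From `x J = y J'` and `N(J) = N(J')` the principal ideals `(x)` and `(y)` have equal norm.
  -- Element norms are nonnegative, so `x / y` has norm exactly `1`, and it carries `J` to `J'`.
  obtain ⟨x, y, hx, hy, e⟩ := ClassGroup.mk0_eq_mk0_iff.1 h
  simp only at e
  have hxF : (x : F) ≠ 0 := fun h => hx (RingOfIntegers.coe_injective (by simpa using h))
  have hyF : (y : F) ≠ 0 := fun h => hy (RingOfIntegers.coe_injective (by simpa using h))
  have hJ0 : Ideal.absNorm J ≠ 0 := by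
    rw [Ne, Ideal.absNorm_eq_zero_iff]; exact nonZeroDivisors.ne_zero hJ
  have hxy : Ideal.absNorm (Ideal.span {x}) = Ideal.absNorm (Ideal.span {y}) := by
    have := congrArg Ideal.absNorm e
    rw [map_mul, map_mul, ← hn] at this
    exact Nat.eq_of_mul_eq_mul_right (Nat.pos_of_ne_zero hJ0) this
  have hnorm : ∀ z : 𝓞 F, Algebra.norm ℚ (z : F) = (Ideal.absNorm (Ideal.span {z}) : ℚ) := by
    intro z
    rw [Ideal.absNorm_span_singleton]
    have h1 : ((Algebra.norm ℤ z : ℤ) : ℚ) = Algebra.norm ℚ (z : F) :=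
      Algebra.coe_norm_int z
    have h2 := hN z
    rw [← h1] at h2 ⊢
    have h3 : 0 ≤ Algebra.norm ℤ z := by exact_mod_cast h2
    rw [← Int.cast_natCast (R := ℚ), Int.natAbs_of_nonneg h3]
  have hu : Algebra.norm ℚ ((x : F) / y) = 1 := by
    have h1 : Algebra.norm ℚ ((x : F) / y) * Algebra.norm ℚ (y : F) = Algebra.norm ℚ (x : F) := by
      rw [← map_mul, div_mul_cancel₀ _ hyF]
    rw [hnorm x, hxy, ← hnorm y] at h1
    exact mul_right_cancel₀ (b := Algebra.norm ℚ (y : F))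
      (by rw [Ne, Algebra.norm_eq_zero_iff]; exact hyF) (by rw [h1, one_mul])
  let g : F ≃ₗ[ℚ] F := LinearEquiv.ofBijective (LinearMap.mulLeft ℚ ((x : F) / y))
    (mulLeft_bijective₀ _ (div_ne_zero hxF hyF))
  have hg : ∀ z, g z = (x : F) / y * z := fun _ => rfl
  rw [cls_eq_iff]
  refine ⟨g, hG.mul_mem _ hu g hg, ?_⟩
  ext z
  rw [mem_image]
  constructor
  · rintro ⟨_, ⟨k, hk, rfl⟩, rfl⟩
    have : x * k ∈ Ideal.span {y} * J' := by
      rw [← e]; exact Ideal.mul_mem_mul (Ideal.mem_span_singleton_self x) hk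
    obtain ⟨k', hk', e'⟩ := Ideal.mem_span_singleton_mul.1 this
    refine ⟨k', hk', ?_⟩
    have e2 : (y : F) * k' = x * k := by
      have := congrArg (algebraMap (𝓞 F) F) e'
      simpa using this
    change (k' : F) = (x : F) / y * k
    rw [div_mul_eq_mul_div, eq_div_iff hyF]
    linear_combination e2
  · rintro ⟨k', hk', rfl⟩
    have : y * k' ∈ Ideal.span {x} * J := by
      rw [e]; exact Ideal.mul_mem_mul (Ideal.mem_span_singleton_self y) hk'
    obtain ⟨k, hk, e'⟩ := Ideal.mem_span_singleton_mul.1 this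
    refine ⟨k, ⟨k, hk, rfl⟩, ?_⟩
    have e2 : (x : F) * k = y * k' := by
      have := congrArg (algebraMap (𝓞 F) F) e'
      simpa using this
    change (x : F) / y * k = (k' : F)
    rw [div_mul_eq_mul_div, div_eq_iff hyF]
    linear_combination e2

/-- Sending a class to the ideal class of its representative is injective, since all these
representatives have the same norm. -/
theorem card_idealClasses_le (hG : IsNormGroup G)
    (hN : ∀ x : F, 0 ≤ Algebra.norm ℚ x) {I : Ideal (𝓞 F)} (hI : I ≠ ⊥) {n : ℕ} (hn : n ≠ 0) :
    (idealClasses G I n).card ≤ classNumber F := by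
  have hmem : ∀ c ∈ idealClasses G I n,
      classCofactor G I n c * I ∈ nonZeroDivisors (Ideal (𝓞 F)) := fun c hc =>
    mem_nonZeroDivisors_of_ne_zero (mul_ne_bot_of_absNorm hI hn (classCofactor_spec hc).1)
  rw [classNumber, ← Fintype.card_coe]
  refine Fintype.card_le_of_injective
    (fun c : idealClasses G I n => ClassGroup.mk0 ⟨classCofactor G I n c * I, hmem c c.2⟩) ?_
  rintro ⟨c, hc⟩ ⟨c', hc'⟩ h
  have h1 := classCofactor_spec hc
  have h2 := classCofactor_spec hc'
  have := cls_eq_of_mk0_eq hG hN (hmem c hc) (hmem c' hc')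
    (by rw [map_mul, map_mul, h1.1, h2.1]) h
  rw [h1.2, h2.2] at this
  exact Subtype.ext this

theorem finite_cls_primitiveLattices (hF : Module.finrank ℚ F = 2) {J : Ideal (𝓞 F)} (hJ : J ≠ ⊥)
    {f : ℕ} (hf : f ≠ 0) : (cls G '' primitiveLattices J f).Finite :=
  (finite_primitiveLattices hF hJ hf).image _

theorem sublattices_latticeOf (I : Ideal (𝓞 F)) (m : ℕ) :
    sublattices (latticeOf I.toAddSubgroup) m = latticeOf '' subgroupsOfIndex I m := by
  ext M
  constructor
  · rintro ⟨h1, h2⟩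
    obtain ⟨K, hK, rfl⟩ := exists_eq_latticeOf h1
    exact ⟨K, ⟨hK, by rwa [relIndex_latticeOf] at h2⟩, rfl⟩
  · rintro ⟨K, ⟨h1, h2⟩, rfl⟩
    exact ⟨latticeOf_le_iff.2 h1, by rw [relIndex_latticeOf, h2]⟩

/-- Sorting the classes of sublattices by the class of the ideal that they generate. -/
theorem ncard_cls_sublattices (hG : IsNormGroup G) (hF : Module.finrank ℚ F = 2)
    {I : Ideal (𝓞 F)} (hI : I ≠ ⊥) {m : ℕ} (hm : m ≠ 0) :
    (cls G '' sublattices (latticeOf I.toAddSubgroup) m).ncard =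
      ∑ p ∈ m.divisorsAntidiagonal, ∑ c ∈ idealClasses G I p.1,
        (cls G '' primitiveLattices (classCofactor G I p.1 c * I) p.2).ncard := by
  have hcond : ∀ p ∈ m.divisorsAntidiagonal, ∀ c ∈ idealClasses G I p.1,
      classCofactor G I p.1 c * I ≠ ⊥ ∧ p.2 ≠ 0 := by
    intro p hp c hc
    rw [Nat.mem_divisorsAntidiagonal] at hp
    have : p.1 * p.2 ≠ 0 := by rw [hp.1]; exact hm
    exact ⟨mul_ne_bot_of_absNorm hI (left_ne_zero_of_mul this) (classCofactor_spec hc).1,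
      right_ne_zero_of_mul this⟩
  refine ncard_eq_sum_sum m.divisorsAntidiagonal (fun p => idealClasses G I p.1)
    (fun p c => cls G '' primitiveLattices (classCofactor G I p.1 c * I) p.2)
    (cls G '' sublattices (latticeOf I.toAddSubgroup) m) ?_ ?_ ?_ ?_
  · exact fun p hp c hc => finite_cls_primitiveLattices hF (hcond p hp c hc).1 (hcond p hp c hc).2
  · rintro p hp c hc _ ⟨_, ⟨K, hK, rfl⟩, rfl⟩
    rw [sublattices_latticeOf]
    have hle := Ideal.mul_le_right (I := classCofactor G I p.1 c) (J := I)
    refine ⟨_, ⟨K, ⟨(le_of_mem_primitiveSubgroups hK).trans hle, ?_⟩, rfl⟩, rfl⟩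
    rw [← AddSubgroup.relIndex_mul_relIndex K (classCofactor G I p.1 c * I).toAddSubgroup
      I.toAddSubgroup (le_of_mem_primitiveSubgroups hK) hle, hK.2, relIndex_mul_ideal _ hI,
      (classCofactor_spec hc).1, mul_comm, (Nat.mem_divisorsAntidiagonal.1 hp).1]
  · rintro p hp c hc q hq d hd _ ⟨M, hM, rfl⟩ ⟨M', hM', e⟩
    obtain ⟨g, hg, rfl⟩ := cls_eq_iff.1 e.symm
    obtain ⟨h1, h2⟩ := image_eq_of_primitiveLattices hF (hG.norm_apply g hg) hM hM'
    refine ⟨Prod.ext ?_ h2, ?_⟩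
    · have hp' := Nat.mem_divisorsAntidiagonal.1 hp
      have hq' := Nat.mem_divisorsAntidiagonal.1 hq
      have : p.1 * p.2 = q.1 * p.2 := by rw [hp'.1, h2, hq'.1]
      exact Nat.eq_of_mul_eq_mul_right (Nat.pos_of_ne_zero (hcond p hp c hc).2) this
    · rw [← (classCofactor_spec hc).2, ← (classCofactor_spec hd).2]
      exact cls_eq_iff.2 ⟨g, hg, h1⟩
  · intro k hk
    rw [sublattices_latticeOf] at hk
    obtain ⟨_, ⟨K, hK, rfl⟩, rfl⟩ := hk
    obtain ⟨a, ha, hp⟩ := exists_span_eq_mul hI hm hK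
    have hcm : cls G (latticeOf (a * I).toAddSubgroup) ∈ idealClasses G I (Ideal.absNorm a) :=
      mem_idealClasses.2 ⟨a, rfl, rfl⟩
    -- Move `K` by the element that takes its ideal `a * I` to the chosen representative of the same
    -- class.
    obtain ⟨g, hg, hgJ⟩ := cls_eq_iff.1 (classCofactor_spec hcm).2.symm
    exact ⟨_, hp, _, hcm, image g (latticeOf K),
      image_mem_primitiveLattices hF (hG.norm_apply g hg) hgJ ⟨K, ⟨ha, rfl⟩, rfl⟩, cls_image hg _⟩

end Orbits

/-! ### Main term and error term of the counting function -/

section Decomposition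

open scoped LSeries.notation
open scoped ComplexOrder

variable {F : Type*} [Field F] [NumberField F] {G : Subgroup (F ≃ₗ[ℚ] F)}

/-- Comparison of the abscissas of absolute convergence of two Dirichlet series. -/
theorem abscissaOfAbsConv_le_of_norm_le {f g : ℕ → ℂ} {x : EReal}
    (hg : LSeries.abscissaOfAbsConv g ≤ x) (h : ∀ n ≠ 0, ‖f n‖ ≤ ‖g n‖) :
    LSeries.abscissaOfAbsConv f ≤ x := by
  refine LSeries.abscissaOfAbsConv_le_of_forall_lt_LSeriesSummable' fun y hy => ?_
  have hs : LSeriesSummable g (y : ℂ) :=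
    LSeriesSummable_of_abscissaOfAbsConv_lt_re (by simpa using hg.trans_lt hy)
  refine Summable.of_norm_bounded hs.norm fun n => ?_
  rcases eq_or_ne n 0 with rfl | hn
  · simp
  · exact LSeries.norm_term_le _ (h n hn)

theorem abscissaOfAbsConv_convolution_le {f g : ℕ → ℂ} {x : EReal}
    (hf : LSeries.abscissaOfAbsConv f ≤ x) (hg : LSeries.abscissaOfAbsConv g ≤ x) :
    LSeries.abscissaOfAbsConv (f ⍟ g) ≤ x :=
  (LSeries.abscissaOfAbsConv_convolution_le f g).trans (max_le hf hg)

/-- The majorant has the coefficients of `B ζ(s)³`, a convolution of constant sequences. -/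
theorem abscissaOfAbsConv_sum_card_divisors_le (B : ℝ) {f : ℕ → ℂ}
    (h : ∀ n ≠ 0, ‖f n‖ ≤ B * ∑ p ∈ n.divisorsAntidiagonal, (p.2.divisors.card : ℝ)) :
    LSeries.abscissaOfAbsConv f ≤ 1 := by
  have h1 : LSeries.abscissaOfAbsConv (fun _ => (B : ℂ)) ≤ 1 :=
    LSeries.abscissaOfAbsConv_le_of_le_const ⟨‖(B : ℂ)‖, fun _ _ => le_rfl⟩
  have h2 := abscissaOfAbsConv_convolution_le LSeries.abscissaOfAbsConv_one.le
    LSeries.abscissaOfAbsConv_one.le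
  refine abscissaOfAbsConv_le_of_norm_le (abscissaOfAbsConv_convolution_le h1 h2) fun n hn =>
    (h n hn).trans ?_
  have e : ((fun _ => (B : ℂ)) ⍟ (1 ⍟ 1)) n =
      ((B * ∑ p ∈ n.divisorsAntidiagonal, (p.2.divisors.card : ℝ) : ℝ) : ℂ) := by
    rw [LSeries.convolution_def]
    push_cast
    rw [Finset.mul_sum]
    refine Finset.sum_congr rfl fun p _ => ?_
    rw [LSeries.convolution_def]
    simp only [Pi.one_apply, mul_one, Finset.sum_const, nsmul_eq_mul]
    rw [← Nat.map_div_right_divisors, Finset.card_map]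
  rw [e, Complex.norm_real]
  exact le_abs_self _

/-- The average contribution of `±1` to the classes of sublattices generating an ideal of index
`n` in `I`. -/
noncomputable def classWeight (G : Subgroup (F ≃ₗ[ℚ] F)) (I : Ideal (𝓞 F)) (n : ℕ) : ℝ :=
  ∑ c ∈ idealClasses G I n, 2 / (Nat.card (idealStabilizer G (classCofactor G I n c * I)) : ℝ)

theorem classWeight_nonneg (I : Ideal (𝓞 F)) (n : ℕ) : 0 ≤ classWeight G I n :=
  Finset.sum_nonneg fun _ _ => by positivity

/-- Each summand is at most `1`, as the stabilizer contains `±1`, and there are at most `h`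
summands. -/
theorem classWeight_le (hG : IsNormGroup G) (hF : Module.finrank ℚ F = 2)
    (hN : ∀ x : F, 0 ≤ Algebra.norm ℚ x) {I : Ideal (𝓞 F)} (hI : I ≠ ⊥) {n : ℕ} (hn : n ≠ 0) :
    classWeight G I n ≤ classNumber F := by
  obtain ⟨C, hC⟩ := exists_classes_bound hF hN
  refine (Finset.sum_le_card_nsmul _ _ 1 fun c hc => ?_).trans ?_
  · have h := (hC G hG _ (mul_ne_bot_of_absNorm hI hn (classCofactor_spec hc).1)).1
    have h' : (2 : ℝ) ≤ Nat.card (idealStabilizer G (classCofactor G I n c * I)) := by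
      exact_mod_cast h
    rw [div_le_one (by linarith)]
    exact h'
  · rw [nsmul_eq_mul, mul_one]
    exact_mod_cast card_idealClasses_le hG hN hI hn

theorem classWeight_one_pos (hG : IsNormGroup G) (hF : Module.finrank ℚ F = 2)
    (hN : ∀ x : F, 0 ≤ Algebra.norm ℚ x) {I : Ideal (𝓞 F)} (hI : I ≠ ⊥) :
    0 < classWeight G I 1 := by
  obtain ⟨C, hC⟩ := exists_classes_bound hF hN
  refine Finset.sum_pos (fun c hc => ?_) ⟨_, mem_idealClasses.2 ⟨⊤, Ideal.absNorm_top, rfl⟩⟩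
  have h := (hC G hG _ (mul_ne_bot_of_absNorm hI one_ne_zero (classCofactor_spec hc).1)).1
  have h' : (2 : ℝ) ≤ Nat.card (idealStabilizer G (classCofactor G I 1 c * I)) := by
    exact_mod_cast h
  exact div_pos two_pos (by linarith)

/-- Sum of the Burnside estimates over at most `h` classes of ideals for each norm; their constant
`C` is uniform in the ideal. -/
theorem exists_abs_count_sub_le (hF : Module.finrank ℚ F = 2)
    (hN : ∀ x : F, 0 ≤ Algebra.norm ℚ x) (hG : IsNormGroup G) {I : Ideal (𝓞 F)} (hI : I ≠ ⊥) :
    ∃ B : ℝ, ∀ m ≠ 0, |((cls G '' sublattices (latticeOf I.toAddSubgroup) m).ncard : ℝ) -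
      ∑ p ∈ m.divisorsAntidiagonal, classWeight G I p.1 * primitiveCount F p.2| ≤
        B * ∑ p ∈ m.divisorsAntidiagonal, (p.2.divisors.card : ℝ) := by
  obtain ⟨C, hC⟩ := exists_classes_bound hF hN
  refine ⟨classNumber F * C, fun m hm => ?_⟩
  rw [ncard_cls_sublattices hG hF hI hm]
  push_cast
  rw [← Finset.sum_sub_distrib, Finset.mul_sum]
  refine (Finset.abs_sum_le_sum_abs _ _).trans (Finset.sum_le_sum fun p hp => ?_)
  rw [Nat.mem_divisorsAntidiagonal] at hp
  have hne : p.1 * p.2 ≠ 0 := by rw [hp.1]; exact hm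
  have hp1 := left_ne_zero_of_mul hne
  rw [classWeight, Finset.sum_mul, ← Finset.sum_sub_distrib]
  refine (Finset.abs_sum_le_sum_abs _ _).trans ?_
  refine (Finset.sum_le_card_nsmul _ _ (C * p.2.divisors.card : ℝ) fun c hc => ?_).trans ?_
  · exact (hC G hG _ (mul_ne_bot_of_absNorm hI hp1 (classCofactor_spec hc).1)).2 p.2
      (right_ne_zero_of_mul hne)
  · rw [nsmul_eq_mul, mul_assoc]
    have : ((idealClasses G I p.1).card : ℝ) ≤ classNumber F := by
      exact_mod_cast card_idealClasses_le hG hN hI hp1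
    gcongr

/-- The counting function of classes of sublattices of an ideal has a zeta decomposition. -/
theorem exists_zetaDecomposition (hF : Module.finrank ℚ F = 2)
    (hN : ∀ x : F, 0 ≤ Algebra.norm ℚ x) (hG : IsNormGroup G) {I : Ideal (𝓞 F)} (hI : I ≠ ⊥) :
    ∃ α ψ β ι : ℕ → ℂ, ZetaDecomposition
      (fun m => ((cls G '' sublattices (latticeOf I.toAddSubgroup) m).ncard : ℂ)) α ψ β ι := by
  obtain ⟨B, hB⟩ := exists_abs_count_sub_le hF hN hG hI
  refine ⟨fun n => (classWeight G I n : ℂ), fun n => (primitiveCount F n : ℂ),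
    fun m => (((cls G '' sublattices (latticeOf I.toAddSubgroup) m).ncard -
      ∑ p ∈ m.divisorsAntidiagonal, classWeight G I p.1 * primitiveCount F p.2 : ℝ) : ℂ),
    fun n => (idealCount F n : ℂ), ?_⟩
  refine ⟨?_, ?_, ?_, ?_, ?_, ?_, abscissaOfAbsConv_idealCount F,
    fun s hs => LSeries_idealCount_ne_zero F hs, ?_, ?_⟩
  · exact fun m => Nat.cast_nonneg _
  · intro m _
    rw [LSeries.convolution_def]
    push_cast
    ring
  · exact fun n => Complex.zero_le_real.2 (classWeight_nonneg I n)
  · exact Complex.zero_lt_real.2 (classWeight_one_pos hG hF hN hI)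
  · refine LSeries.abscissaOfAbsConv_le_of_le_const ⟨classNumber F, fun n hn => ?_⟩
    rw [Complex.norm_real, Real.norm_of_nonneg (classWeight_nonneg I n)]
    exact classWeight_le hG hF hN hI hn
  · refine abscissaOfAbsConv_sum_card_divisors_le B fun m hm => ?_
    rw [Complex.norm_real]
    exact hB m hm
  · refine abscissaOfAbsConv_le_of_norm_le (abscissaOfAbsConv_convolution_le (f := 1)
      (LSeries.abscissaOfAbsConv_one.le.trans (by norm_num)) abscissaOfAbsConv_natCast_le)
      fun n hn => ?_
    rw [LSeries.convolution_def]
    simp only [Pi.one_apply, one_mul]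
    rw [Nat.sum_divisorsAntidiagonal' (f := fun _ y => (y : ℂ)), ← Nat.cast_sum,
      Complex.norm_natCast, Complex.norm_natCast]
    exact_mod_cast primitiveCount_le hF hn
  · intro m hm
    rw [LSeries.convolution_def, ← sum_idealCount_mul_primitiveCount hF hm]
    push_cast
    rfl

end Decomposition

/-! ### Transport of lattices and classes along a linear isomorphism -/

section Transport

variable {V : Type*} [AddCommGroup V] [Module ℚ V] {W : Type*} [AddCommGroup W] [Module ℚ W]

/-- Conjugation by a linear isomorphism. -/
def conjHom (φ : V ≃ₗ[ℚ] W) : (W ≃ₗ[ℚ] W) →* (V ≃ₗ[ℚ] V) where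
  toFun g := (φ.trans g).trans φ.symm
  map_one' := by ext x; simp
  map_mul' g h := by ext x; simp

@[simp]
theorem conjHom_apply (φ : V ≃ₗ[ℚ] W) (g : W ≃ₗ[ℚ] W) (x : V) :
    conjHom φ g x = φ.symm (g (φ x)) := rfl

/-- The image of a lattice under a linear isomorphism. -/
def transport (φ : V ≃ₗ[ℚ] W) (K : Submodule ℤ V) : Submodule ℤ W :=
  K.map ((φ : V →ₗ[ℚ] W).restrictScalars ℤ)

theorem mem_transport {φ : V ≃ₗ[ℚ] W} {K : Submodule ℤ V} {x : W} :
    x ∈ transport φ K ↔ ∃ k ∈ K, φ k = x := Iff.rfl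

theorem transport_symm_transport (φ : V ≃ₗ[ℚ] W) (K : Submodule ℤ W) :
    transport φ (transport φ.symm K) = K := by
  ext x
  simp [mem_transport]

theorem transport_injective (φ : V ≃ₗ[ℚ] W) : Function.Injective (transport φ) :=
  Submodule.map_injective_of_injective φ.injective

theorem transport_image (φ : V ≃ₗ[ℚ] W) (g : W ≃ₗ[ℚ] W) (K : Submodule ℤ V) :
    transport φ (image (conjHom φ g) K) = image g (transport φ K) := by
  ext x
  simp [mem_transport, mem_image]

theorem transport_sublattices (φ : V ≃ₗ[ℚ] W) (L : Submodule ℤ V) (m : ℕ) :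
    transport φ '' sublattices L m = sublattices (transport φ L) m := by
  have hrel : ∀ K : Submodule ℤ V,
      (transport φ K).toAddSubgroup.relIndex (transport φ L).toAddSubgroup =
        K.toAddSubgroup.relIndex L.toAddSubgroup := fun K =>
    AddSubgroup.relIndex_map_map_of_injective K.toAddSubgroup L.toAddSubgroup
      (f := (φ : V →ₗ[ℚ] W).toAddMonoidHom) φ.injective
  ext M
  constructor
  · rintro ⟨K, ⟨h1, h2⟩, rfl⟩
    exact ⟨Submodule.map_mono h1, by rw [hrel, h2]⟩
  · rintro ⟨h1, h2⟩
    obtain ⟨K, rfl⟩ : ∃ K, transport φ K = M := ⟨_, transport_symm_transport φ M⟩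
    rw [hrel] at h2
    exact ⟨K, ⟨(Submodule.map_le_map_iff_of_injective
      (f := (φ : V →ₗ[ℚ] W).restrictScalars ℤ) φ.injective _ _).1 h1, h2⟩, rfl⟩

theorem transport_cls (φ : V ≃ₗ[ℚ] W) (G : Subgroup (V ≃ₗ[ℚ] V)) (K : Submodule ℤ V) :
    transport φ '' cls G K = cls (G.comap (conjHom φ)) (transport φ K) := by
  ext M
  constructor
  · rintro ⟨_, ⟨σ, hσ, rfl⟩, rfl⟩
    have e : conjHom φ ((φ.symm.trans σ).trans φ) = σ := by ext x; simp
    refine ⟨(φ.symm.trans σ).trans φ, ?_, ?_⟩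
    · rw [Subgroup.mem_comap, e]; exact hσ
    · rw [← transport_image, e]
  · rintro ⟨g, hg, rfl⟩
    exact ⟨_, ⟨conjHom φ g, hg, rfl⟩, transport_image φ g K⟩

/-- The number of classes of sublattices is invariant under transport of structure. -/
theorem ncard_cls_transport (φ : V ≃ₗ[ℚ] W) (G : Subgroup (V ≃ₗ[ℚ] V)) (L : Submodule ℤ V)
    (m : ℕ) : (cls (G.comap (conjHom φ)) '' sublattices (transport φ L) m).ncard =
      (cls G '' sublattices L m).ncard := by
  rw [← Set.ncard_image_of_injective (cls G '' sublattices L m)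
    (transport_injective φ).image_injective, ← transport_sublattices, Set.image_image, Set.image_image]
  simp_rw [transport_cls]

end Transport

/-! ### The ring of integers of a quadratic field from its discriminant -/

section IntegralBasis

variable {F : Type*} [Field F] [NumberField F]

/-- The discriminant of the pair `1, o`. -/
theorem discr_one_pair (hF : Module.finrank ℚ F = 2) (o : 𝓞 F) :
    algebraMap ℚ F (Algebra.discr ℤ ![(1 : 𝓞 F), o] : ℤ) =
      (2 * (o : F) - algebraMap ℚ F (Algebra.trace ℚ F o)) ^ 2 := by
  have h2 := sq_eq_trace_mul_sub_norm hF (o : F)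
  have ht : Algebra.trace ℚ F ((o : F) ^ 2) =
      Algebra.trace ℚ F (o : F) ^ 2 - 2 * Algebra.norm ℚ (o : F) := by
    rw [h2, map_sub, ← Algebra.smul_def, map_smul, trace_algebraMap_of_finrank_two hF, smul_eq_mul,
      sq]
  have h1 : Algebra.trace ℚ F (1 : F) = 2 := by
    simpa using trace_algebraMap_of_finrank_two hF 1
  have hd : ((Algebra.discr ℤ ![(1 : 𝓞 F), o] : ℤ) : ℚ) =
      Algebra.trace ℚ F (o : F) ^ 2 - 4 * Algebra.norm ℚ (o : F) := by
    rw [Algebra.discr_def, Matrix.det_fin_two]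
    simp only [Algebra.traceMatrix_apply, Algebra.traceForm_apply, Matrix.cons_val_zero,
      Matrix.cons_val_one, one_mul, mul_one]
    push_cast
    rw [Algebra.coe_trace_int, Algebra.coe_trace_int, Algebra.coe_trace_int]
    change Algebra.trace ℚ F (1 : F) * Algebra.trace ℚ F ((o : F) * o) - _ = _
    rw [← sq, ht, h1]
    change _ - Algebra.trace ℚ F (o : F) * Algebra.trace ℚ F (o : F) = _
    ring
  rw [hd, map_sub, map_mul, map_pow, map_ofNat]
  linear_combination (-4) * h2

theorem discr_pair_eq_sq_mul (ω : Module.Basis (Fin 2) ℤ (𝓞 F)) (v : Fin 2 → 𝓞 F) :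
    Algebra.discr ℤ v = ω.det v ^ 2 * discr F := by
  rw [← discr_eq_discr F ω, Module.Basis.det_apply, ← Algebra.discr_of_matrix_vecMul,
    Module.Basis.toMatrix_map_vecMul]

/-- The discriminant of a pair `1, o` is both `(2 o - Tr o)²` and `k² discr F`, with `k` the
determinant of the pair in an integral basis. Choose `o` with `k ≠ 0` and divide. -/
theorem exists_sq_eq_discr (hF : Module.finrank ℚ F = 2) :
    ∃ δ : F, δ ^ 2 = algebraMap ℚ F (discr F : ℚ) ∧ Algebra.trace ℚ F δ = 0 := by
  let ω := quadraticBasis hF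
  obtain ⟨o, ho⟩ : ∃ o : 𝓞 F, ω.det ![1, o] ≠ 0 := by
    by_contra hcon
    push Not at hcon
    have h : ∀ o : 𝓞 F, ω.repr 1 0 * ω.repr o 1 = ω.repr 1 1 * ω.repr o 0 := fun o => by
      have := hcon o
      rw [Module.Basis.det_apply, Matrix.det_fin_two] at this
      simp only [Module.Basis.toMatrix_apply, Matrix.cons_val_zero, Matrix.cons_val_one] at this
      linarith
    have h0 := h (ω 0)
    have h1 := h (ω 1)
    simp at h0 h1
    have : ω.repr 1 = 0 := by
      ext i; fin_cases i
      · simpa using h1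
      · simpa using h0.symm
    rw [LinearEquiv.map_eq_zero_iff] at this
    exact one_ne_zero this
  set k : ℚ := ((ω.det ![1, o] : ℤ) : ℚ) with hk
  have hk0 : k ≠ 0 := by rw [hk]; exact_mod_cast ho
  have hkF : algebraMap ℚ F k ≠ 0 := by simpa using hk0
  have h1 := discr_one_pair hF o
  rw [discr_pair_eq_sq_mul ω] at h1
  rw [Int.cast_mul, Int.cast_pow, ← hk, map_mul, map_pow] at h1
  refine ⟨algebraMap ℚ F k⁻¹ * (2 * (o : F) - algebraMap ℚ F (Algebra.trace ℚ F o)), ?_, ?_⟩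
  · rw [mul_pow, ← h1, map_inv₀]
    field_simp
  · rw [← Algebra.smul_def, map_smul, map_sub, trace_algebraMap_of_finrank_two hF]
    have : Algebra.trace ℚ F (2 * (o : F)) = 2 * Algebra.trace ℚ F (o : F) := by
      have := (Algebra.trace ℚ F).map_smul 2 (o : F)
      rw [Algebra.smul_def] at this
      simpa using this
    rw [this, sub_self, smul_zero]

/-- If `b² - 4n` is the discriminant of the quadratic field `F`, the ring of integers of `F` is
`ℤ[θ]` with `θ² = b θ - n`. -/
theorem exists_integral_generator (hF : Module.finrank ℚ F = 2) {b n : ℤ}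
    (hD : discr F = b ^ 2 - 4 * n) :
    ∃ θ : 𝓞 F, θ ^ 2 = b * θ - n ∧ Algebra.trace ℚ F (θ : F) = b ∧
      ∀ o : 𝓞 F, ∃ x y : ℤ, o = x + y * θ := by
  obtain ⟨δ, hδ, htr⟩ := exists_sq_eq_discr hF
  set t : F := ((b : F) + δ) / 2 with ht
  have h2 : (2 : F) ≠ 0 := two_ne_zero
  have h2t : 2 * t = b + δ := by rw [ht]; field_simp
  have hδ' : δ ^ 2 = (b : F) ^ 2 - 4 * n := by
    rw [hδ, hD]; simp
  have hsq : t ^ 2 = b * t - n := by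
    have h4 : (4 : F) * (t ^ 2 - (b * t - n)) = 0 := by
      linear_combination (2 * t + b + δ - 2 * b) * h2t + hδ'
    have h4' : (4 : F) ≠ 0 := by norm_num
    exact sub_eq_zero.1 ((mul_eq_zero.1 h4).resolve_left h4')
  have hint : IsIntegral ℤ t := by
    refine ⟨Polynomial.X ^ 2 - Polynomial.C b * Polynomial.X + Polynomial.C n, ?_, ?_⟩
    · monicity!
    · simp only [Polynomial.eval₂_add, Polynomial.eval₂_sub, Polynomial.eval₂_mul,
        Polynomial.eval₂_pow, Polynomial.eval₂_X, Polynomial.eval₂_C, hsq]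
      simp
  have htrt : Algebra.trace ℚ F t = b := by
    have := congrArg (Algebra.trace ℚ F) h2t
    have e1 : (2 : F) * t = (2 : ℚ) • t := by rw [Algebra.smul_def]; simp
    have e2 : (b : F) = algebraMap ℚ F (b : ℚ) := by simp
    rw [e1, map_smul, map_add, e2, trace_algebraMap_of_finrank_two hF, htr, smul_eq_mul] at this
    linarith
  let θ : 𝓞 F := ⟨t, hint⟩
  have hθ : (θ : F) = t := rfl
  let ω := quadraticBasis hF
  refine ⟨θ, RingOfIntegers.coe_injective ?_, htrt, ?_⟩
  · simp only [map_pow, map_sub, map_mul, map_intCast]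
    exact hsq
  -- The pair `1, θ` has discriminant `δ² = discr F`, so its determinant in an integral basis
  -- squares to `1` and the pair is itself an integral basis.
  · have hd := discr_one_pair hF θ
    have hDF : ((discr F : ℤ) : ℚ) ≠ 0 := by exact_mod_cast discr_ne_zero F
    rw [hθ, htrt, h2t, discr_pair_eq_sq_mul ω] at hd
    have hd2 : algebraMap ℚ F (((ω.det ![1, θ] ^ 2 * discr F : ℤ)) : ℚ) =
        algebraMap ℚ F (discr F : ℚ) := by
      rw [hd, ← hδ]; simp
    have hd3 := (algebraMap ℚ F).injective hd2
    push_cast at hd3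
    have hd4 : ((ω.det ![1, θ] : ℤ) : ℚ) ^ 2 = 1 := mul_right_cancel₀ hDF (by rw [hd3, one_mul])
    have hd5 : (ω.det ![1, θ]) ^ 2 = 1 := by exact_mod_cast hd4
    have hu : IsUnit (ω.det ![1, θ]) := IsUnit.of_mul_eq_one _ (by rw [← sq]; exact hd5)
    have hspan := ((Module.Basis.is_basis_iff_det ω).2 hu).2
    intro o
    have : o ∈ Submodule.span ℤ (Set.range ![1, θ]) := by rw [hspan]; trivial
    rw [Matrix.range_cons, Matrix.range_cons, Matrix.range_empty, Set.union_empty,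
      Set.singleton_union, Submodule.mem_span_pair] at this
    obtain ⟨x, y, h⟩ := this
    exact ⟨x, y, by rw [← h]; simp⟩

end IntegralBasis

/-! ### From the quadratic space to an ideal with its norm form -/

section Realization

variable {V : Type*} [AddCommGroup V] [Module ℚ V]

theorem bilin_self (Q : QuadraticForm ℚ V) (x : V) : bilin Q x x = Q x :=
  QuadraticMap.associated_eq_self_apply ℚ Q x

theorem two_mul_bilin (Q : QuadraticForm ℚ V) (x y : V) :
    2 * bilin Q x y = QuadraticMap.polar Q x y := by
  have h := LinearMap.congr_fun₂ (QuadraticMap.two_nsmul_associated ℚ Q) x y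
  simpa [bilin, two_mul, two_nsmul] using h

theorem apply_eq_of_mem_orthogonal {Q : QuadraticForm ℚ V} {σ : V ≃ₗ[ℚ] V}
    (hσ : σ ∈ orthogonal Q) (x : V) : Q (σ x) = Q x := by
  rw [← bilin_self, ← bilin_self]
  exact hσ x x

theorem mem_orthogonal_of_apply_eq {Q : QuadraticForm ℚ V} {σ : V ≃ₗ[ℚ] V}
    (hσ : ∀ x, Q (σ x) = Q x) : σ ∈ orthogonal Q := by
  intro x y
  have h : 2 * bilin Q (σ x) (σ y) = 2 * bilin Q x y := by
    rw [two_mul_bilin, two_mul_bilin, QuadraticMap.polar, QuadraticMap.polar, ← map_add, hσ, hσ, hσ]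
  exact mul_left_cancel₀ two_ne_zero h

variable {F : Type*} [Field F] [NumberField F]

/-- A quadratic space similar to the norm form of a quadratic field has norm groups as
orthogonal groups. -/
theorem isNormGroup_comap {Q : QuadraticForm ℚ V} {φ : F ≃ₗ[ℚ] V} {κ : ℚ} (hκ : κ ≠ 0)
    (hφ : ∀ x, κ * Q (φ x) = Algebra.norm ℚ x) {G : Subgroup (V ≃ₗ[ℚ] V)}
    (h1 : G ≤ orthogonal Q) (h2 : specialOrthogonal Q ≤ G) :
    IsNormGroup (G.comap (conjHom φ.symm)) := by
  refine ⟨fun g hg x => ?_, fun u hu g hg => h2 ⟨?_, ?_⟩⟩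
  · have h := apply_eq_of_mem_orthogonal (h1 hg) (φ x)
    rw [← hφ, ← hφ]
    simpa using congrArg (κ * ·) h
  · refine mem_orthogonal_of_apply_eq fun x => mul_left_cancel₀ hκ ?_
    obtain ⟨y, rfl⟩ := φ.surjective x
    have : conjHom φ.symm g (φ y) = φ (g y) := by simp
    rw [this, hφ, hφ, hg, map_mul, hu, one_mul]
  · change conjHom φ.symm g ∈ (LinearEquiv.det (R := ℚ) (M := V)).ker
    rw [MonoidHom.mem_ker]
    apply Units.ext
    rw [LinearEquiv.coe_det, Units.val_one]
    -- The determinant of multiplication by `u` is the norm of `u`, so these maps are proper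
    -- isometries.
    have e : ((conjHom φ.symm g : V ≃ₗ[ℚ] V) : V →ₗ[ℚ] V) =
        (φ : F →ₗ[ℚ] V) ∘ₗ LinearMap.mulLeft ℚ u ∘ₗ (φ.symm : V →ₗ[ℚ] F) := by
      ext x; simp [hg]
    rw [e, LinearMap.det_conj, ← hu]
    rfl

/-- A binary lattice whose discriminant is that of the quadratic field `F` is similar to an
ideal of `F` with its norm form. -/
theorem exists_realization (Q : QuadraticForm ℚ V) (hQ : Q.PosDef)
    (L : Submodule ℤ V) [Submodule.IsLattice ℚ L] (hL : ∀ x ∈ L, ∃ n : ℤ, Q x = n)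
    (e : Module.Basis (Fin 2) ℤ L) (hF : Module.finrank ℚ F = 2)
    (hD : (discr F : ℚ) = -4 * (gramMatrix Q e).det) :
    ∃ (φ : F ≃ₗ[ℚ] V) (κ : ℚ) (I : Ideal (𝓞 F)), 0 < κ ∧
      (∀ x, κ * Q (φ x) = Algebra.norm ℚ x) ∧ I ≠ ⊥ ∧
        transport φ.symm L = latticeOf I.toAddSubgroup := by
  obtain ⟨a, ha⟩ := hL (e 0) (e 0).2
  obtain ⟨c, hc⟩ := hL (e 1) (e 1).2
  obtain ⟨s, hs⟩ := hL ((e 0 : V) + e 1) (add_mem (e 0).2 (e 1).2)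
  set b : ℤ := s - a - c with hb
  have hpol : QuadraticMap.polar Q (e 0 : V) (e 1) = b := by
    rw [QuadraticMap.polar, hs, ha, hc, hb]; push_cast; ring
  have hD' : discr F = b ^ 2 - 4 * (a * c) := by
    have h1 := two_mul_bilin Q (e 0 : V) (e 1)
    have h2 := two_mul_bilin Q (e 1 : V) (e 0)
    rw [QuadraticMap.polar_comm] at h2
    rw [hpol] at h1 h2
    rw [Matrix.det_fin_two] at hD
    simp only [gramMatrix, Matrix.of_apply, bilin_self, ha, hc] at hD
    have : (discr F : ℚ) = b ^ 2 - 4 * (a * c) := by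
      rw [hD]
      linear_combination (2 * bilin Q (e 1 : V) (e 0)) * h1 + (b : ℚ) * h2
    exact_mod_cast this
  obtain ⟨θ, hθ, htr, hgen⟩ := exists_integral_generator hF hD'
  have hθF : (θ : F) ^ 2 = b * θ - a * c := by
    have := congrArg (algebraMap (𝓞 F) F) hθ
    simpa using this
  have he0 : (e 0 : V) ≠ 0 := fun h => e.ne_zero 0 (Subtype.ext h)
  have ha0 : (0 : ℚ) < a := by rw [← ha]; exact hQ _ he0
  have haF : (a : F) ≠ 0 := by
    have : a ≠ 0 := by rintro rfl; simp at ha0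
    exact_mod_cast this
  have hnθ : Algebra.norm ℚ (θ : F) = a * c := by
    have h := sq_eq_trace_mul_sub_norm hF (θ : F)
    rw [htr, hθF] at h
    have : algebraMap ℚ F (Algebra.norm ℚ (θ : F)) = algebraMap ℚ F (a * c) := by
      simp only [map_mul, map_intCast] at h ⊢
      linear_combination h
    exact (algebraMap ℚ F).injective this
  let B : Module.Basis (Fin 2) ℚ V := e.extendOfIsLattice ℚ
  have hB : ∀ i, B i = (e i : V) := fun i => Module.Basis.extendOfIsLattice_apply ℚ e i
  -- `e 0 ↦ a` and `e 1 ↦ θ`, where `θ` has trace `b` and norm `a c`: the norm of `q a + r θ` is `a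
  -- (a q² + b q r + c r²)`, that is `a` times `Q`.
  let v : Fin 2 → F := ![(a : F), (θ : F)]
  let ψ : V →ₗ[ℚ] F := B.constr ℚ v
  have hψ : ∀ i, ψ (e i : V) = v i := fun i => by rw [← hB]; exact B.constr_basis ℚ v i
  have hrep : ∀ x : V, ∃ q r : ℚ, x = q • (e 0 : V) + r • (e 1 : V) := fun x => by
    refine ⟨B.repr x 0, B.repr x 1, ?_⟩
    conv_lhs => rw [← B.sum_repr x]
    rw [Fin.sum_univ_two, hB, hB]
  have hψ2 : ∀ q r : ℚ, ψ (q • (e 0 : V) + r • (e 1 : V)) =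
      r • (θ : F) + algebraMap ℚ F (q * a) := fun q r => by
    rw [map_add, map_smul, map_smul, hψ, hψ, add_comm]
    simp [v, Algebra.smul_def]
  have hnorm : ∀ x, Algebra.norm ℚ (ψ x) = a * Q x := fun x => by
    obtain ⟨q, r, rfl⟩ := hrep x
    rw [hψ2, norm_add_algebraMap hF, (Algebra.trace ℚ F).map_smul, htr, Algebra.smul_def r,
      map_mul (Algebra.norm ℚ), norm_algebraMap_of_finrank_two hF, hnθ]
    have h1 : Q (q • (e 0 : V) + r • (e 1 : V)) =
        Q (q • (e 0 : V)) + Q (r • (e 1 : V)) +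
          QuadraticMap.polar Q (q • (e 0 : V)) (r • (e 1 : V)) := by
      rw [QuadraticMap.polar]; ring
    rw [h1, QuadraticMap.map_smul, QuadraticMap.map_smul, QuadraticMap.polar_smul_left,
      QuadraticMap.polar_smul_right, hpol, ha, hc]
    simp only [smul_eq_mul]
    ring
  have hinj : Function.Injective ψ := by
    rw [injective_iff_map_eq_zero]
    intro x hx
    by_contra hx0
    have := hnorm x
    rw [hx, Algebra.norm_zero] at this
    have h2 := mul_pos ha0 (hQ x hx0)
    linarith
  have hfr : Module.finrank ℚ V = Module.finrank ℚ F := by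
    rw [Module.finrank_eq_card_basis B, hF, Fintype.card_fin]
  have : FiniteDimensional ℚ V := Module.Finite.of_basis B
  let Ψ : V ≃ₗ[ℚ] F := LinearEquiv.ofInjectiveOfFinrankEq ψ hinj hfr
  have hΨ : ∀ x, Ψ x = ψ x := fun x => rfl
  refine ⟨Ψ.symm, a, Ideal.span {(a : 𝓞 F), θ}, ha0, fun x => ?_, ?_, ?_⟩
  · rw [← hnorm, ← hΨ, LinearEquiv.apply_symm_apply]
  · intro h
    rw [Ideal.span_eq_bot] at h
    have h0 := h (a : 𝓞 F) (by simp)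
    exact haF (by simpa using congrArg (algebraMap (𝓞 F) F) h0)
  · have hI : ∀ z : 𝓞 F, z ∈ Ideal.span {(a : 𝓞 F), θ} ↔ ∃ x y : ℤ, z = x * a + y * θ := by
      intro z
      rw [Ideal.mem_span_pair]
      constructor
      · rintro ⟨p, q, rfl⟩
        obtain ⟨p0, p1, rfl⟩ := hgen p
        obtain ⟨q0, q1, rfl⟩ := hgen q
        -- Reduce with `θ² = b θ - a c`: the lattice `ℤ a + ℤ θ` is already an ideal.
        refine ⟨p0 - q1 * c, p1 * a + q0 + q1 * b, ?_⟩
        push_cast at hθ ⊢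
        linear_combination (q1 : 𝓞 F) * hθ
      · rintro ⟨x, y, rfl⟩
        exact ⟨x, y, rfl⟩
    have hψz : ∀ x y : ℤ, Ψ (((x • e 0 + y • e 1 : L)) : V) =
        ((x * a + y * θ : 𝓞 F) : F) := fun x y => by
      have e1 : ((x • e 0 + y • e 1 : L) : V) = (x : ℚ) • (e 0 : V) + (y : ℚ) • (e 1 : V) := by
        simp [Int.cast_smul_eq_zsmul]
      rw [e1, hΨ, hψ2]
      simp [Algebra.smul_def]
      ring
    ext z
    rw [LinearEquiv.symm_symm, mem_transport, mem_latticeOf]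
    constructor
    · rintro ⟨k, hk, rfl⟩
      have hk2 := e.sum_repr ⟨k, hk⟩
      rw [Fin.sum_univ_two] at hk2
      refine ⟨_, (hI _).2 ⟨e.repr ⟨k, hk⟩ 0, e.repr ⟨k, hk⟩ 1, rfl⟩, ?_⟩
      rw [← hψz, hk2]
    · rintro ⟨k, hk, rfl⟩
      obtain ⟨x, y, rfl⟩ := (hI k).1 hk
      exact ⟨_, (x • e 0 + y • e 1 : L).2, hψz x y⟩

end Realization

end SublatticeZeta

/-! ### The main theorem -/

open SublatticeZeta in
theorem theorem1p4 {V : Type*} [AddCommGroup V] [Module ℚ V]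
    (Q : QuadraticForm ℚ V) (hQ : Q.PosDef)
    (L : Submodule ℤ V) [Submodule.IsLattice ℚ L]
    (hL : ∀ x ∈ L, ∃ n : ℤ, Q x = n)
    (e : Module.Basis (Fin 2) ℤ L)
    {F : Type*} [Field F] [NumberField F]
    (hF : Module.finrank ℚ F = 2) [NumberField.IsTotallyComplex F]
    (hD : (NumberField.discr F : ℚ) = -4 * (SublatticeZeta.gramMatrix Q e).det) :
    (∃ f : ℂ → ℂ,
      (∀ s : ℂ, 2 < s.re → LSeriesSummable (SublatticeZeta.properCoeff Q L) s ∧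
        f s = SublatticeZeta.properZeta Q L s) ∧
      MeromorphicOn f {s : ℂ | 1 < s.re} ∧
      meromorphicOrderAt f 2 = -1 ∧
      ∀ s : ℂ, 1 < s.re → s ≠ 2 → AnalyticAt ℂ f s) ∧
    (∃ g : ℂ → ℂ,
      (∀ s : ℂ, 2 < s.re → LSeriesSummable (SublatticeZeta.coeff Q L) s ∧
        g s = SublatticeZeta.zeta Q L s) ∧
      MeromorphicOn g {s : ℂ | 1 < s.re} ∧
      meromorphicOrderAt g 2 = -1 ∧
      ∀ s : ℂ, 1 < s.re → s ≠ 2 → AnalyticAt ℂ g s) ∧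
    SublatticeZeta.abscissaOfConvergence (SublatticeZeta.properCoeff Q L) = 2 ∧
    SublatticeZeta.abscissaOfConvergence (SublatticeZeta.coeff Q L) = 2 := by
  obtain ⟨φ, κ, I, hκ, hφ, hI, hLI⟩ := exists_realization Q hQ L hL e hF hD
  have hN : ∀ x : F, 0 ≤ Algebra.norm ℚ x := fun x => by
    rw [← hφ]
    exact mul_nonneg hκ.le (hQ.nonneg _)
  -- The argument needs only that `G` consists of isometries and contains the proper ones, so both
  -- zeta functions are treated at once.
  have key : ∀ G : Subgroup (V ≃ₗ[ℚ] V), G ≤ orthogonal Q → specialOrthogonal Q ≤ G →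
      ∃ α ψ β ι : ℕ → ℂ, ZetaDecomposition
        (fun m => ((cls G '' sublattices L m).ncard : ℂ)) α ψ β ι := by
    intro G h1 h2
    have h := exists_zetaDecomposition hF hN (isNormGroup_comap hκ.ne' hφ h1 h2) hI
    rw [← hLI] at h
    simpa only [ncard_cls_transport] using h
  obtain ⟨α, ψ, β, ι, h⟩ := key (specialOrthogonal Q) inf_le_left le_rfl
  obtain ⟨α', ψ', β', ι', h'⟩ := key (orthogonal Q) le_rfl inf_le_left
  exact ⟨⟨_, fun s hs => h.summable_and_eq hs, h.meromorphicOn_continuation,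
      h.meromorphicOrderAt_continuation, fun s => h.analyticAt_continuation⟩,
    ⟨_, fun s hs => h'.summable_and_eq hs, h'.meromorphicOn_continuation,
      h'.meromorphicOrderAt_continuation, fun s => h'.analyticAt_continuation⟩,
    h.abscissaOfConvergence_eq, h'.abscissaOfConvergence_eq⟩
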